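/- Let $\delta>0$, $M>0$, $B>0$ and $Q\ge 1$, and put $\varkappa=\frac{\delta}{2(4+\delta)}$. There exist constants $K>0$ and $C>0$, depending only on $Q,\delta,M,B$, such that the following holds for all integers $1\le n<N$ and all $p\in[0,1]$ with $$Np\ \ge\ B\,(\ln N)^{\frac{3}{2\varkappa}}\qquad\text{and}\qquad p\ \ge\ \frac{B}{\ln^4 N}.$$ Let $X_{jk}$, $1\le j\le N$, $1\le k\le n$, be independent identically distributed real random variables (whose distribution may depend on $N$ and $n$) with $\mathbb E X_{jk}=0$, $\mathbb E X_{jk}^2=1$ and $\mathbb E|X_{jk}|^{4+\delta}\le M$. Let $\xi_{jk}$, $1\le j\le N$, $1\le k\le n$, be independent Bernoulli random variables with $\Pr\{\xi_{jk}=1\}=p=1-\Pr\{\xi_{jk}=0\}$, the family $(\xi_{jk})$ being independent of the family $(X_{jk})$. Let $s_1$ be the largest singular value of the $N\times n$ matrix $\mathbf X=(\xi_{jk}X_{jk})$. Then $$\Pr\{s_1\ge K\sqrt{Np}\}\ \le\ C N^{-Q}+\frac{C}{\ln^{\delta}N}.$$ -/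

import Mathlib

open MeasureTheory ProbabilityTheory

/-- The random `N × n` matrix with entries `ξ j k * X j k`, at the sample point `ω`. -/
def diluteMatrix {Ω : Type*} {N n : ℕ} (ξ X : Fin N → Fin n → Ω → ℝ) (ω : Ω) :
    Matrix (Fin N) (Fin n) ℝ :=
  Matrix.of fun j k => ξ j k ω * X j k ω

/-- The largest singular value of a real matrix, as a map between Euclidean spaces
(`LinearMap.singularValues` is decreasing and indexed from `0`). -/
noncomputable def largestSingularValue {N n : ℕ} (A : Matrix (Fin N) (Fin n) ℝ) : ℝ :=
  (Matrix.toEuclideanLin A).singularValues 0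

/-- The data of the dilute (sparse) model: `X j k` are i.i.d. real random variables with mean zero
and variance one, `ξ j k` are independent Bernoulli variables with success probability `p`, and the
family `ξ` is independent of the family `X`. -/
structure IsDiluteModel {Ω : Type*} [MeasurableSpace Ω] (P : Measure Ω) {N n : ℕ}
    (p : unitInterval) (ξ X : Fin N → Fin n → Ω → ℝ) : Prop where
  measurable_entry : ∀ j k, Measurable (X j k)
  measurable_mask : ∀ j k, Measurable (ξ j k)
  iIndepFun_entry : iIndepFun (fun i : Fin N × Fin n => X i.1 i.2) P
  identDistrib_entry : ∀ j k j' k', IdentDistrib (X j k) (X j' k') P P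
  integrable_sq : ∀ j k, Integrable (fun ω => X j k ω ^ 2) P
  mean_zero : ∀ j k, ∫ ω, X j k ω ∂P = 0
  variance_one : ∀ j k, ∫ ω, X j k ω ^ 2 ∂P = 1
  iIndepFun_mask : iIndepFun (fun i : Fin N × Fin n => ξ i.1 i.2) P
  law_mask : ∀ j k, HasLaw (ξ j k) (bernoulliMeasure 1 0 p) P
  indep_mask_entry : IndepFun (fun ω (i : Fin N × Fin n) => ξ i.1 i.2 ω)
    (fun ω (i : Fin N × Fin n) => X i.1 i.2 ω) P

/-- The exponent `ϰ = δ / (2 (4 + δ))`. -/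
noncomputable def sparsityExponent (δ : ℝ) : ℝ := δ / (2 * (4 + δ))

/-! The proof truncates the entries and applies the trace method at order `m ≈ log N`, but replaces
the usual enumeration of walks by comparison with a small reference matrix.

Truncate at `T = N ^ ((1 - ϰ) / 2)` and recentre. By Markov and a union bound some entry exceeds `T`
with probability at most `M N ^ (-δ/4)`. Otherwise the matrix is a bounded centred masked matrix
plus a masked matrix of truncated means, whose Frobenius norm is at most `√(N p)`.

For the bounded part, the expected trace of `(A Aᵀ) ^ m` is a sum over closed bipartite walks, and
by centring only walks using every edge at least twice survive. Take `r ≈ log² N` and `D² = p N /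
r`: entry moments of order `l ≥ 2` are at most `(r/N) D ^ l`, so each distinct edge costs `r/N`. A
walk has at most one more vertex than edges (`card_image_walk_le`), so up to a factor `N/r` each
vertex costs `r/N`. This is the density that turns a sum over walks on `N` and `n` vertices into a
count of walks on `r` and `r` vertices (`sum_doubledWalk_le`).

That count is bounded by the expected trace for an `r × r` matrix of independent centred dice whose
higher moments are all at least one. A net argument shows that its norm is of order `√r`, so there
are at most `2 r (c r) ^ m` doubled walks (`card_doubledWalk_le`). Hence the expected trace is at
most `8 N (c N p) ^ m`, and Markov's inequality finishes. -/

/-! ### Trace moments and closed bipartite walks. -/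

open Finset in
/-- Powers of a square matrix as sums over walks. -/
lemma Matrix.pow_apply_eq_sum_walks {I : Type*} [Fintype I] [DecidableEq I] (A : Matrix I I ℝ)
    (m : ℕ) (i j : I) :
    (A ^ m) i j = ∑ w : Fin (m + 1) → I, if w 0 = i ∧ w (Fin.last m) = j then
      ∏ k : Fin m, A (w k.castSucc) (w k.succ) else 0 := by
  induction m generalizing i with
  | zero =>
    rw [← (Equiv.funUnique (Fin 1) I).symm.sum_comp]
    simp only [pow_zero, Matrix.one_apply]
    rw [Finset.sum_eq_single i] <;> simp +contextual [Equiv.funUnique, uniqueElim]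
  | succ m ih =>
    rw [pow_succ', Matrix.mul_apply, ← (Fin.consEquiv (fun _ => I)).sum_comp,
      Fintype.sum_prod_type]
    simp only [ih, mul_sum]
    rw [sum_comm]
    rw [sum_eq_single i]
    · refine sum_congr rfl fun w _ => ?_
      rw [sum_eq_single (w 0)]
      · simp only [Fin.consEquiv_apply, Fin.cons_zero, true_and, Fin.prod_univ_succ,
          Fin.castSucc_zero, Fin.cons_succ, Fin.castSucc_succ, ← Fin.succ_last, mul_ite, mul_zero]
      · intro b _ hb
        simp [hb.symm]
      · simp
    · intro b _ hb
      simp [hb]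
    · simp

/-- The list of edges of a bipartite walk `w 0, v 0, w 1, v 1, …, w m`. -/
def walkEdge {I J : Type*} {m : ℕ} (w : Fin (m + 1) → I) (v : Fin m → J) :
    Fin m ⊕ Fin m → I × J :=
  Sum.elim (fun k => (w k.castSucc, v k)) (fun k => (w k.succ, v k))

open Finset in
/-- The moments of the singular values as sums over closed bipartite walks. -/
lemma Matrix.trace_mul_transpose_pow {I J : Type*} [Fintype I] [Fintype J] [DecidableEq I]
    (A : Matrix I J ℝ) (m : ℕ) :
    ((A * A.transpose) ^ m).trace = ∑ w : Fin (m + 1) → I, ∑ v : Fin m → J,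
      if w 0 = w (Fin.last m) then
        ∏ e, A (walkEdge w v e).1 (walkEdge w v e).2 else 0 := by
  classical
  simp only [Matrix.trace, Matrix.diag_apply, Matrix.pow_apply_eq_sum_walks]
  rw [sum_comm]
  refine sum_congr rfl fun w _ => ?_
  rw [sum_eq_single (w 0)]
  · by_cases h : w 0 = w (Fin.last m)
    · simp only [h, and_self, if_true, Matrix.mul_apply, Matrix.transpose_apply]
      rw [Finset.prod_univ_sum]
      simp only [Fintype.piFinset_univ, walkEdge, Fintype.prod_sum_type, Sum.elim_inl,
        Sum.elim_inr, prod_mul_distrib]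
    · simp [h, Ne.symm h]
  · intro b _ hb
    simp [hb.symm]
  · simp

-- The graph traced by a walk is connected, so it has at most one more vertex than edges. In the
-- induction, each new vertex brings a new edge with it.
open Finset in
lemma card_image_walk_le {I J : Type*} [DecidableEq I] [DecidableEq J] {m : ℕ}
    (w : Fin (m + 1) → I) (v : Fin m → J) :
    #(univ.image w) + #(univ.image v) ≤ #(univ.image (walkEdge w v)) + 1 := by
  induction m with
  | zero =>
    simp
  | succ m ih =>
    have ih := ih (w ∘ Fin.castSucc) (v ∘ Fin.castSucc)
    set W := univ.image (w ∘ Fin.castSucc)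
    set V := univ.image (v ∘ Fin.castSucc)
    set E := univ.image (walkEdge (w ∘ Fin.castSucc) (v ∘ Fin.castSucc))
    have hW : univ.image w = insert (w (Fin.last _)) W := by
      ext x; simp [W, Fin.exists_fin_succ', eq_comm, or_comm]
    have hV : univ.image v = insert (v (Fin.last _)) V := by
      ext x; simp [V, Fin.exists_fin_succ', eq_comm, or_comm]
    have hE : univ.image (walkEdge w v) =
        insert (w (Fin.last _), v (Fin.last _))
          (insert (w (Fin.last m).castSucc, v (Fin.last _)) E) := by
      ext x
      simp only [mem_image, mem_univ, true_and, walkEdge, Sum.exists, Sum.elim_inl, Sum.elim_inr,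
        Fin.exists_fin_succ', E, mem_insert, Function.comp_apply, Fin.succ_last,
        Fin.succ_castSucc, eq_comm]
      tauto
    have hEW : ∀ x ∈ E, x.1 ∈ W ∧ x.2 ∈ V := by
      intro x hx
      obtain ⟨e, -, rfl⟩ := mem_image.1 hx
      rcases e with e | e <;>
        simp only [walkEdge, Sum.elim_inl, Sum.elim_inr, W, V] <;>
        exact ⟨mem_image.2 ⟨_, mem_univ _, rfl⟩, mem_image.2 ⟨_, mem_univ _, rfl⟩⟩
    have hlast : w (Fin.last m).castSucc ∈ W := by simp [W]
    rw [hW, hV, hE]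
    by_cases h1 : w (Fin.last _) ∈ W <;> by_cases h2 : v (Fin.last _) ∈ V
    · rw [insert_eq_of_mem h1, insert_eq_of_mem h2]
      exact ih.trans (by gcongr; exact (subset_insert _ _).trans (subset_insert _ _))
    · rw [insert_eq_of_mem h1, card_insert_of_notMem h2]
      have : #(insert (w (Fin.last m).castSucc, v (Fin.last _)) E) = #E + 1 :=
        card_insert_of_notMem fun h => h2 (hEW _ h).2
      have : #(insert (w (Fin.last m).castSucc, v (Fin.last _)) E) ≤ _ :=
        card_le_card (subset_insert (w (Fin.last _), v (Fin.last _)) _)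
      omega
    · rw [card_insert_of_notMem h1, insert_eq_of_mem h2, card_insert_of_notMem]
      · have : #E ≤ _ := card_le_card (subset_insert (w (Fin.last m).castSucc, v (Fin.last _)) E)
        omega
      · rw [mem_insert, not_or]
        refine ⟨fun h => h1 ?_, fun h => h1 (hEW _ h).1⟩
        rwa [(Prod.mk.inj h).1]
    · rw [card_insert_of_notMem h1, card_insert_of_notMem h2, card_insert_of_notMem,
        card_insert_of_notMem]
      · omega
      · exact fun h => h2 (hEW _ h).2
      · rw [mem_insert, not_or]
        refine ⟨fun h => h1 ?_, fun h => h1 (hEW _ h).1⟩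
        rwa [(Prod.mk.inj h).1]

/-! ### Transfer of sums over maps from a large to a small set of values. -/

open Finset in
/-- The number of functions with the same kernel as a given function. -/
lemma card_filter_ker_eq {ι α β : Type*} [Fintype ι] [DecidableEq ι] [Fintype α] [DecidableEq α]
    [DecidableEq β] (u₀ : ι → β) :
    #{u : ι → α | ∀ i j, u i = u j ↔ u₀ i = u₀ j} =
      (Fintype.card α).descFactorial #(univ.image u₀) := by
  classical
  have h0 : ∀ x : {x // x ∈ univ.image u₀}, ∃ i, u₀ i = x := fun x => by
    obtain ⟨i, -, hi⟩ := mem_image.1 x.2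
    exact ⟨i, hi⟩
  choose s hs using h0
  -- A map with the kernel of `u₀` is an embedding of the image of `u₀`.
  rw [← Fintype.card_coe (univ.image u₀), ← Fintype.card_embedding_eq, ← Fintype.card_subtype]
  refine Fintype.card_congr
    { toFun := fun u => ⟨fun x => u.1 (s x), fun x y h => ?_⟩
      invFun := fun e => ⟨fun i => e ⟨u₀ i, by simp⟩, fun i j => ?_⟩
      left_inv := fun u => ?_
      right_inv := fun e => ?_ }
  · have := (u.2 _ _).1 h
    rw [hs, hs] at this
    exact Subtype.ext this
  · simp
  · ext i
    exact (u.2 _ _).2 (hs _)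
  · ext x
    simp [hs]

open Finset in
lemma card_image_eq_of_ker_eq {ι α β : Type*} [Fintype ι] [DecidableEq α]
    [DecidableEq β] {u : ι → α} {v : ι → β} (h : ∀ i j, u i = u j ↔ v i = v j) :
    #(univ.image u) = #(univ.image v) := by
  rcases isEmpty_or_nonempty ι with hι | hι
  · simp
  have h1 : ∀ x ∈ univ.image u, ∃ i, u i = x := fun x hx => by simpa using hx
  choose! s hs using h1
  refine card_bij' (fun x _ => v (s x)) (fun y hy => u ((mem_image.1 hy).choose)) ?_ ?_ ?_ ?_
  · simp
  · simp
  · intro x hx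
    generalize_proofs hp
    have := hp.choose_spec.2
    rw [(h _ _).2 this, hs x hx]
  · intro y hy
    generalize_proofs hp
    exact ((h _ _).1 (hs _ (by simp))).trans hp.choose_spec.2

/-- Each factor is at least `r - a`, and Bernoulli gives `(1 - a/r) ^ a ≥ 1 - a²/r ≥ 1/2`. -/
lemma pow_le_two_mul_descFactorial {r a : ℕ} (h : 2 * a ^ 2 ≤ r) :
    (r : ℝ) ^ a ≤ 2 * (r.descFactorial a : ℝ) := by
  rcases Nat.eq_zero_or_pos a with rfl | ha
  · simp
  have har : a ≤ r := by nlinarith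
  have hr : (0 : ℝ) < r := by exact_mod_cast ha.trans_le har
  have h1 : ((r - a : ℕ) : ℝ) ^ a ≤ r.descFactorial a := by
    exact_mod_cast (Nat.pow_le_pow_left (by omega) a).trans (r.pow_sub_le_descFactorial a)
  have h2 := one_add_mul_le_pow (a := -(a / r : ℝ)) (by
    have : (a : ℝ) / r ≤ 1 := by rw [div_le_one hr]; exact_mod_cast har
    linarith) a
  have h3 : (a : ℝ) * (a / r) ≤ 1 / 2 := by
    rw [mul_div_assoc', div_le_div_iff₀ hr (by norm_num)]
    have : (2 * a ^ 2 : ℝ) ≤ r := by exact_mod_cast h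
    linarith
  have h4 : (r : ℝ) ^ a * (1 + -(a / r : ℝ)) ^ a = ((r - a : ℕ) : ℝ) ^ a := by
    rw [← mul_pow, Nat.cast_sub har]
    congr 1
    field_simp
    ring
  have h5 : (1 / 2 : ℝ) ≤ (1 + -(a / r : ℝ)) ^ a := by linarith
  have h6 : (r : ℝ) ^ a * (1 / 2) ≤ (r : ℝ) ^ a * (1 + -(a / r : ℝ)) ^ a := by gcongr
  linarith

open Finset in
/-- Comparison of sums of kernel-invariant weights over functions to a large and to a small
set of values. -/
lemma sum_pow_card_image_mul_le {ι α ρ : Type*} [Fintype ι] [DecidableEq ι] [Fintype α] [DecidableEq α]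
    [Fintype ρ] [DecidableEq ρ] (f : (ι → α) → ℝ) (g : (ι → ρ) → ℝ)
    (hfg : ∀ u u', (∀ i j, u i = u j ↔ u' i = u' j) → f u = g u') (hg : ∀ u', 0 ≤ g u')
    (hα : 0 < Fintype.card α) (hρ : 2 * Fintype.card ι ^ 2 ≤ Fintype.card ρ) :
    ∑ u, ((Fintype.card ρ : ℝ) / Fintype.card α) ^ #(univ.image u) * f u ≤ 2 * ∑ u', g u' := by
  classical
  -- On maps with a fixed kernel having `a` classes the summands are constant, so only class sizes
  -- matter: the falling factorial of `|α|`, times `(|ρ|/|α|) ^ a`, is at most `|ρ| ^ a`, which is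
  -- at most twice the falling factorial of `|ρ|`.
  rw [← sum_fiberwise univ (fun (u : ι → α) (i j : ι) => u i = u j),
    ← sum_fiberwise univ (fun (u : ι → ρ) (i j : ι) => u i = u j), mul_sum]
  refine sum_le_sum fun R _ => ?_
  rcases (univ.filter fun u : ι → α => (fun i j => u i = u j) = R).eq_empty_or_nonempty with h | h
  · rw [h, sum_empty]
    exact mul_nonneg (by norm_num) (sum_nonneg fun u _ => hg u)
  obtain ⟨u₀, hu₀⟩ := h
  simp only [mem_filter, mem_univ, true_and] at hu₀
  subst hu₀
  set a := #(univ.image u₀) with ha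
  have e1 : #{u : ι → α | (fun i j => u i = u j) = fun i j => u₀ i = u₀ j} =
      (Fintype.card α).descFactorial a := by
    rw [ha, ← card_filter_ker_eq (α := α) u₀]
    congr 1
    ext u
    simp [funext_iff]
  have hai : 2 * a ^ 2 ≤ Fintype.card ρ := by
    refine le_trans ?_ hρ
    have : a ≤ Fintype.card ι := card_image_le
    gcongr
  have hpos : 0 < (Fintype.card ρ).descFactorial a := by
    rw [Nat.descFactorial_pos]
    nlinarith [sq_nonneg ((a : ℤ) - 1)]
  have e2 : #{u : ι → ρ | (fun i j => u i = u j) = fun i j => u₀ i = u₀ j} =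
        (Fintype.card ρ).descFactorial a := by
    rw [ha, ← card_filter_ker_eq (α := ρ) u₀]
    congr 1
    ext u
    simp [funext_iff]
  have hne : (univ.filter fun u : ι → ρ =>
      (fun i j => u i = u j) = fun i j => u₀ i = u₀ j).Nonempty := by
    rwa [← card_pos, e2]
  obtain ⟨u₁, hu₁⟩ := hne
  simp only [mem_filter, mem_univ, true_and, funext_iff, eq_iff_iff] at hu₁
  have hL : ∀ u ∈ univ.filter (fun u : ι → α => (fun i j => u i = u j) = fun i j => u₀ i = u₀ j),
      ((Fintype.card ρ : ℝ) / Fintype.card α) ^ #(univ.image u) * f u =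
      ((Fintype.card ρ : ℝ) / Fintype.card α) ^ a * g u₁ := by
    intro u hu
    simp only [mem_filter, mem_univ, true_and, funext_iff, eq_iff_iff] at hu
    rw [card_image_eq_of_ker_eq hu, hfg u u₁ fun i j => (hu i j).trans (hu₁ i j).symm]
  have hR : ∀ u ∈ univ.filter (fun u : ι → ρ => (fun i j => u i = u j) = fun i j => u₀ i = u₀ j),
      g u = g u₁ := by
    intro u hu
    simp only [mem_filter, mem_univ, true_and, funext_iff, eq_iff_iff] at hu
    rw [← hfg u₀ u fun i j => (hu i j).symm, ← hfg u₀ u₁ fun i j => (hu₁ i j).symm]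
  rw [sum_congr rfl hL, sum_congr rfl hR, sum_const, sum_const, nsmul_eq_mul, nsmul_eq_mul]
  rw [e1, e2, ← mul_assoc, ← mul_assoc]
  refine mul_le_mul_of_nonneg_right ?_ (hg u₁)
  have hα' : (0 : ℝ) < Fintype.card α := by exact_mod_cast hα
  calc ((Fintype.card α).descFactorial a : ℝ) * ((Fintype.card ρ : ℝ) / Fintype.card α) ^ a
      ≤ (Fintype.card α : ℝ) ^ a * ((Fintype.card ρ : ℝ) / Fintype.card α) ^ a := by
        gcongr
        exact_mod_cast Nat.descFactorial_le_pow _ _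
    _ = (Fintype.card ρ : ℝ) ^ a := by
        rw [← mul_pow, mul_div_cancel₀ _ hα'.ne']
    _ ≤ _ := pow_le_two_mul_descFactorial hai

/-! ### Doubled walks in large and small graphs. -/

/-- Closed bipartite walks in which every edge is traversed at least twice. -/
def IsDoubledWalk {I J : Type*} {m : ℕ} (w : Fin (m + 1) → I) (v : Fin m → J) : Prop :=
  w 0 = w (Fin.last m) ∧ ∀ e, ∃ e', e' ≠ e ∧ walkEdge w v e' = walkEdge w v e

/-- Coincidences between edges depend only on coincidences between vertices; this makes doubledness
invariant under relabelling, as the transfer requires. -/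
lemma walkEdge_eq_iff {I J I' J' : Type*} {m : ℕ} {w : Fin (m + 1) → I} {v : Fin m → J}
    {w' : Fin (m + 1) → I'} {v' : Fin m → J'} (hw : ∀ i j, w i = w j ↔ w' i = w' j)
    (hv : ∀ i j, v i = v j ↔ v' i = v' j) (e e' : Fin m ⊕ Fin m) :
    walkEdge w v e = walkEdge w v e' ↔ walkEdge w' v' e = walkEdge w' v' e' := by
  rcases e with e | e <;> rcases e' with e' | e' <;> simp [walkEdge, hw, hv]

lemma isDoubledWalk_congr {I J I' J' : Type*} {m : ℕ} {w : Fin (m + 1) → I} {v : Fin m → J}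
    {w' : Fin (m + 1) → I'} {v' : Fin m → J'} (hw : ∀ i j, w i = w j ↔ w' i = w' j)
    (hv : ∀ i j, v i = v j ↔ v' i = v' j) : IsDoubledWalk w v ↔ IsDoubledWalk w' v' := by
  simp only [IsDoubledWalk, hw, walkEdge_eq_iff hw hv]

open Finset Classical in
/-- Doubled walks in a large complete bipartite graph, weighted according to their number of
vertices, against all doubled walks in a small one. -/
lemma sum_doubledWalk_le {I J : Type*} [Fintype I] [Fintype J] [DecidableEq I]
    [DecidableEq J] {m r : ℕ}
    (hJ : 0 < Fintype.card J) (hJI : Fintype.card J ≤ Fintype.card I)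
    (hr : 2 * (m + 1) ^ 2 ≤ r) :
    ∑ w : Fin (m + 1) → I, ∑ v : Fin m → J,
      ((r : ℝ) / Fintype.card I) ^ (#(univ.image w) + #(univ.image v)) *
        (if IsDoubledWalk w v then 1 else 0) ≤
    4 * ∑ w : Fin (m + 1) → Fin r, ∑ v : Fin m → Fin r,
      (if IsDoubledWalk w v then 1 else 0) := by
  have hJ' : (0 : ℝ) < Fintype.card J := by exact_mod_cast hJ
  have h1 : ∀ w : Fin (m + 1) → Fin r, ∑ v : Fin m → J,
      ((r : ℝ) / Fintype.card J) ^ #(univ.image v) * (if IsDoubledWalk w v then 1 else 0) ≤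
      2 * ∑ v : Fin m → Fin r, (if IsDoubledWalk w v then (1 : ℝ) else 0) := by
    intro w
    have := sum_pow_card_image_mul_le (ι := Fin m) (α := J) (ρ := Fin r)
      (fun v => if IsDoubledWalk w v then 1 else 0) (fun v => if IsDoubledWalk w v then 1 else 0)
      (fun u u' h => by simp only [isDoubledWalk_congr (fun i j => Iff.rfl) h])
      (fun u => by positivity) hJ (by
        simp only [Fintype.card_fin]
        exact le_trans (by gcongr; omega) hr)
    simpa only [Fintype.card_fin] using this
  have h2 := sum_pow_card_image_mul_le (ι := Fin (m + 1)) (α := I) (ρ := Fin r)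
    (fun w => ∑ v : Fin m → J, ((r : ℝ) / Fintype.card J) ^ #(univ.image v) *
      (if IsDoubledWalk w v then 1 else 0))
    (fun w => ∑ v : Fin m → J, ((r : ℝ) / Fintype.card J) ^ #(univ.image v) *
      (if IsDoubledWalk w v then 1 else 0))
    (fun u u' h => by simp only [isDoubledWalk_congr h (fun i j => Iff.rfl)])
    (fun u => by positivity) (by omega) (by simpa only [Fintype.card_fin] using hr)
  simp only [Fintype.card_fin] at h2
  -- Since `|J| ≤ |I|`, the weight of the `J`-vertices may be raised to `r/|J|`. Each side is then
  -- transferred with its own ratio, at the price of a factor `2`.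
  calc _ ≤ ∑ w : Fin (m + 1) → I, ((r : ℝ) / Fintype.card I) ^ #(univ.image w) *
        ∑ v : Fin m → J, ((r : ℝ) / Fintype.card J) ^ #(univ.image v) *
      (if IsDoubledWalk w v then 1 else 0) := by
        simp only [mul_sum]
        refine sum_le_sum fun w _ => sum_le_sum fun v _ => ?_
        rw [pow_add, mul_assoc]
        gcongr
    _ ≤ _ := h2
    _ ≤ 2 * ∑ w : Fin (m + 1) → Fin r, 2 * ∑ v : Fin m → Fin r,
        (if IsDoubledWalk w v then (1 : ℝ) else 0) := by
        gcongr with w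
        exact h1 w
    _ = _ := by rw [← mul_sum, ← mul_assoc]; norm_num

/-! ### Products of moments along a walk. -/

open Finset in
lemma exists_ne_iff_card_fiber_ne_one {ε κ : Type*} [Fintype ε] [DecidableEq κ]
    (f : ε → κ) : (∀ e, ∃ e', e' ≠ e ∧ f e' = f e) ↔ ∀ x, #{e | f e = x} ≠ 1 := by
  classical
  constructor
  · intro h x hx
    obtain ⟨e, he⟩ := card_eq_one.1 hx
    have h1 : e ∈ ({e} : Finset ε) := mem_singleton_self e
    rw [← he, mem_filter] at h1
    obtain ⟨e', hne, h2⟩ := h e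
    have : e' ∈ ({e} : Finset ε) := by
      rw [← he, mem_filter]
      exact ⟨mem_univ _, h2.trans h1.2⟩
    exact hne (mem_singleton.1 this)
  · intro h e
    have h1 : 0 < #{e' | f e' = f e} := card_pos.2 ⟨e, by simp⟩
    have h2 : 1 < #{e' | f e' = f e} := lt_of_le_of_ne h1 (h (f e)).symm
    obtain ⟨e', he', hne⟩ := exists_mem_ne h2 e
    exact ⟨e', hne, by simpa using he'⟩

open Finset in
lemma prod_comp_eq_prod_pow {ε κ : Type*} [Fintype ε] [Fintype κ] [DecidableEq κ]
    (f : ε → κ) (A : κ → ℝ) : ∏ e, A (f e) = ∏ x, A x ^ #{e | f e = x} := by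
  rw [← prod_fiberwise univ f]
  refine prod_congr rfl fun x _ => ?_
  rw [prod_congr rfl (g := fun _ => A x), prod_const]
  intro e he
  rw [(mem_filter.1 he).2]

-- A value taken once contributes a vanishing first moment. Otherwise every value taken contributes
-- one `q`, and the multiplicities in the exponent of `D` add up to the number of indices.
open Finset Classical in
lemma abs_prod_moments_le {ε κ : Type*} [Fintype ε] [Fintype κ] [DecidableEq κ]
    (f : ε → κ) {μ : κ → ℕ → ℝ} {q D : ℝ} (h0 : ∀ x, μ x 0 = 1) (h1 : ∀ x, μ x 1 = 0)
    (h2 : ∀ x k, 2 ≤ k → |μ x k| ≤ q * D ^ k) :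
    |∏ x, μ x #{e | f e = x}| ≤ if (∀ e, ∃ e', e' ≠ e ∧ f e' = f e) then
      q ^ #(univ.image f) * D ^ Fintype.card ε else 0 := by
  split_ifs with h
  · rw [exists_ne_iff_card_fiber_ne_one] at h
    have hsub : ∏ x, μ x #{e | f e = x} = ∏ x ∈ univ.image f, μ x #{e | f e = x} := by
      symm
      refine prod_subset (subset_univ _) fun x _ hx => ?_
      have : #{e | f e = x} = 0 := by
        rw [card_eq_zero, filter_eq_empty_iff]
        intro e _ he
        exact hx (mem_image.2 ⟨e, mem_univ _, he⟩)
      rw [this, h0]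
    rw [hsub, abs_prod]
    calc ∏ x ∈ univ.image f, |μ x #{e | f e = x}|
        ≤ ∏ x ∈ univ.image f, q * D ^ #{e | f e = x} := by
          refine prod_le_prod (fun _ _ => abs_nonneg _) fun x hx => h2 _ _ ?_
          obtain ⟨e, -, he⟩ := mem_image.1 hx
          have : 0 < #{e | f e = x} := card_pos.2 ⟨e, by simpa using he⟩
          have := h x
          omega
      _ = _ := by
          rw [prod_mul_distrib, prod_const, prod_pow_eq_pow_sum]
          congr 2
          exact (card_eq_sum_card_image f univ).symm
  · rw [exists_ne_iff_card_fiber_ne_one] at h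
    push Not at h
    obtain ⟨x, hx⟩ := h
    rw [prod_eq_zero (mem_univ x) (by rw [hx, h1]), abs_zero]

-- The converse estimate, for the reference matrix: its expected trace dominates the number of
-- doubled walks.
open Finset Classical in
lemma one_le_prod_moments {ε κ : Type*} [Fintype ε] [Fintype κ] [DecidableEq κ]
    (f : ε → κ) {μ : ℕ → ℝ} (h0 : μ 0 = 1) (h1 : μ 1 = 0) (h2 : ∀ k, 2 ≤ k → 1 ≤ μ k) :
    (if (∀ e, ∃ e', e' ≠ e ∧ f e' = f e) then 1 else 0) ≤ ∏ x, μ #{e | f e = x} := by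
  have hμ : ∀ k, 0 ≤ μ k := fun k => by
    rcases k with _ | _ | k
    · simp [h0]
    · simp [h1]
    · exact zero_le_one.trans (h2 _ (by omega))
  split_ifs with h
  · rw [exists_ne_iff_card_fiber_ne_one] at h
    refine Finset.prod_induction _ (fun y => 1 ≤ y) (fun _ _ => one_le_mul_of_one_le_of_one_le)
      le_rfl fun x _ => ?_
    have := h x
    rcases Nat.lt_or_ge #{e | f e = x} 2 with h3 | h3
    · have : #{e | f e = x} = 0 := by omega
      rw [this, h0]
    · exact h2 _ h3
  · exact prod_nonneg fun x _ => hμ _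

open Finset Classical in
/-- The trace moments of a matrix whose entries have small normalized moments are dominated by
the number of doubled walks on few vertices. -/
lemma sum_walks_moments_le {I J : Type*} [Fintype I] [Fintype J] [DecidableEq I]
    [DecidableEq J] {m r : ℕ}
    (hJ : 0 < Fintype.card J) (hJI : Fintype.card J ≤ Fintype.card I)
    (hr : 2 * (m + 1) ^ 2 ≤ r) (hrI : r ≤ Fintype.card I) {μ : I × J → ℕ → ℝ} {D : ℝ}
    (hD : 0 ≤ D) (h0 : ∀ x, μ x 0 = 1) (h1 : ∀ x, μ x 1 = 0)
    (h2 : ∀ x k, 2 ≤ k → |μ x k| ≤ (r : ℝ) / Fintype.card I * D ^ k) :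
    ∑ w : Fin (m + 1) → I, ∑ v : Fin m → J, (if w 0 = w (Fin.last m) then
      ∏ x, μ x #{e | walkEdge w v e = x} else 0) ≤
    4 * D ^ (2 * m) * (Fintype.card I / r) * ∑ w : Fin (m + 1) → Fin r, ∑ v : Fin m → Fin r,
      (if IsDoubledWalk w v then 1 else 0) := by
  have hI : (0 : ℝ) < Fintype.card I := by exact_mod_cast hJ.trans_le hJI
  have hr0 : (0 : ℝ) < r := by
    have : 0 < r := lt_of_lt_of_le (by positivity) hr
    exact_mod_cast this
  set q : ℝ := (r : ℝ) / Fintype.card I with hq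
  have hq0 : 0 < q := by positivity
  have hq1 : q ≤ 1 := by
    rw [hq, div_le_one hI]
    exact_mod_cast hrI
  have hqinv : (Fintype.card I : ℝ) / r = q⁻¹ := by rw [hq, inv_div]
  calc _ ≤ ∑ w : Fin (m + 1) → I, ∑ v : Fin m → J, D ^ (2 * m) * q⁻¹ *
        (q ^ (#(univ.image w) + #(univ.image v)) * (if IsDoubledWalk w v then 1 else 0)) := by
        refine sum_le_sum fun w _ => sum_le_sum fun v _ => ?_
        by_cases hw : w 0 = w (Fin.last m)
        · have := (le_abs_self _).trans (abs_prod_moments_le (walkEdge w v) h0 h1 h2)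
          simp only [hw, if_true, IsDoubledWalk, true_and]
          refine this.trans ?_
          split_ifs
          -- As `q ≤ 1`, the bound vertices `≤` edges `+ 1` trades edge weights for vertex weights
          -- at the cost of one `q⁻¹`.
          · have hle : q ^ (#(univ.image (walkEdge w v)) + 1) ≤
                q ^ (#(univ.image w) + #(univ.image v)) :=
              pow_le_pow_of_le_one hq0.le hq1 (card_image_walk_le w v)
            have hc : Fintype.card (Fin m ⊕ Fin m) = 2 * m := by simp [two_mul]
            rw [hc, mul_one, mul_comm (q ^ _), mul_assoc]
            gcongr
            rw [le_inv_mul_iff₀ hq0, ← pow_succ']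
            exact hle
          · simp
        · simp [hw, IsDoubledWalk]
    _ = D ^ (2 * m) * q⁻¹ * ∑ w : Fin (m + 1) → I, ∑ v : Fin m → J,
        (q ^ (#(univ.image w) + #(univ.image v)) * (if IsDoubledWalk w v then 1 else 0)) := by
        simp only [mul_sum]
    _ ≤ D ^ (2 * m) * q⁻¹ * (4 * ∑ w : Fin (m + 1) → Fin r, ∑ v : Fin m → Fin r,
      (if IsDoubledWalk w v then 1 else 0)) := by
        gcongr
        exact sum_doubledWalk_le hJ hJI hr
    _ = _ := by rw [hqinv]; ring

/-! ### The reference matrix of dice. -/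

/-- A centered three-sided die, all of whose moments of order at least two are at least one. -/
def dieValue : Fin 3 → ℝ := ![2, -1, -1]

/-- The square matrix given by a configuration of dice. -/
def dieMatrix {r : ℕ} (ω : Fin r × Fin r → Fin 3) : Matrix (Fin r) (Fin r) ℝ :=
  Matrix.of fun i j => dieValue (ω (i, j))

lemma sum_prod_die {κ : Type*} [Fintype κ] [DecidableEq κ] (g : κ → Fin 3 → ℝ) :
    ∑ ω : κ → Fin 3, ∏ x, g x (ω x) = ∏ x, ∑ c, g x c := by
  rw [Finset.prod_univ_sum, Fintype.piFinset_univ]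

/-- The asymmetry of the die is essential: a symmetric law has zero odd moments and would lose walks
with an edge of multiplicity three. -/
lemma one_le_die_moment {k : ℕ} (hk : 2 ≤ k) : (1 : ℝ) ≤ (∑ c, dieValue c ^ k) / 3 := by
  have h1 : (-1 : ℝ) ≤ (-1) ^ k := by
    rcases neg_one_pow_eq_or ℝ k with h | h <;> rw [h]
    norm_num
  have h2 : (4 : ℝ) ≤ 2 ^ k := by
    calc (4 : ℝ) = 2 ^ 2 := by norm_num
      _ ≤ _ := pow_le_pow_right₀ (by norm_num) hk
  rcases hk.eq_or_lt with rfl | hk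
  · simp [Fin.sum_univ_three, dieValue]; norm_num
  have h3 : (8 : ℝ) ≤ 2 ^ k := by
    calc (8 : ℝ) = 2 ^ 3 := by norm_num
      _ ≤ _ := pow_le_pow_right₀ (by norm_num) hk
  simp only [Fin.sum_univ_three, dieValue, Matrix.cons_val]
  linarith

-- Summing over all `3 ^ (r * r)` outcomes is an unnormalised expectation; it factors over the
-- independent entries.
open Finset Classical in
lemma card_doubledWalk_le_sum_trace (m r : ℕ) :
    3 ^ (r * r) * ∑ w : Fin (m + 1) → Fin r, ∑ v : Fin m → Fin r,
      (if IsDoubledWalk w v then (1 : ℝ) else 0) ≤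
    ∑ ω : Fin r × Fin r → Fin 3, ((dieMatrix ω * (dieMatrix ω).transpose) ^ m).trace := by
  simp only [Matrix.trace_mul_transpose_pow]
  rw [mul_sum, sum_comm (s := (univ : Finset (Fin r × Fin r → Fin 3)))]
  refine sum_le_sum fun w _ => ?_
  rw [mul_sum, sum_comm (s := (univ : Finset (Fin r × Fin r → Fin 3)))]
  refine sum_le_sum fun v _ => ?_
  by_cases hw : w 0 = w (Fin.last m)
  · simp only [hw, if_true, IsDoubledWalk, true_and, dieMatrix, Matrix.of_apply, Prod.mk.eta]
    have h1 : ∀ ω : Fin r × Fin r → Fin 3, ∏ e, dieValue (ω (walkEdge w v e)) =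
        ∏ x, dieValue (ω x) ^ #{e | walkEdge w v e = x} := fun ω =>
      prod_comp_eq_prod_pow (walkEdge w v) fun x => dieValue (ω x)
    simp only [h1]
    rw [sum_prod_die fun x c => dieValue c ^ #{e | walkEdge w v e = x}]
    have h2 := one_le_prod_moments (walkEdge w v) (μ := fun k => (∑ c, dieValue c ^ k) / 3)
      (by simp) (by simp [Fin.sum_univ_three, dieValue]; norm_num)
      (fun k hk => one_le_die_moment hk)
    rw [prod_div_distrib, prod_const, card_univ, Fintype.card_prod, Fintype.card_fin,
      le_div_iff₀' (by positivity)] at h2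
    convert h2 using 2
    congr
  · simp [hw, IsDoubledWalk]

/-- The sums at `s` and `-s` have product `5 + 4 cosh (3 s) ≤ 9 cosh (3 s)`, and the sum at `-s` is
at least `3` because the die is centred. -/
lemma sum_exp_die_le (s : ℝ) : ∑ c, Real.exp (s * dieValue c) ≤ 3 * Real.exp (9 / 2 * s ^ 2) := by
  have h1 : (3 : ℝ) ≤ ∑ c, Real.exp (-(s * dieValue c)) := by
    have : ∑ c, (-(s * dieValue c) + 1) ≤ ∑ c, Real.exp (-(s * dieValue c)) :=
      Finset.sum_le_sum fun c _ => Real.add_one_le_exp _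
    refine le_trans (le_of_eq ?_) this
    simp [Fin.sum_univ_three, dieValue]; ring
  have h2 : (∑ c, Real.exp (s * dieValue c)) * ∑ c, Real.exp (-(s * dieValue c)) =
      5 + 4 * Real.cosh (3 * s) := by
    rw [Real.cosh_eq, Finset.sum_mul_sum]
    simp only [← Real.exp_add, Fin.sum_univ_three, dieValue, Matrix.cons_val]
    ring_nf
    simp only [Real.exp_zero]
    ring
  have h3 : Real.cosh (3 * s) ≤ Real.exp (9 / 2 * s ^ 2) := by
    refine (Real.cosh_le_exp_half_sq _).trans (le_of_eq ?_)
    congr 1; ring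
  have h4 : 1 ≤ Real.cosh (3 * s) := Real.one_le_cosh _
  have h5 : 0 ≤ ∑ c, Real.exp (s * dieValue c) :=
    Finset.sum_nonneg fun c _ => (Real.exp_pos _).le
  nlinarith [mul_le_mul_of_nonneg_left h1 h5]

/-! ### A net of rescaled integer points. -/

/-- Integer points of the Euclidean ball of radius `4 √r`. -/
noncomputable def intBall (r : ℕ) : Finset (Fin r → ℤ) :=
  (Fintype.piFinset fun _ => Finset.Icc (-(16 * r : ℤ)) (16 * r)).filter
    fun z => ∑ i, (z i : ℝ) ^ 2 ≤ 16 * r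

lemma mem_intBall {r : ℕ} {z : Fin r → ℤ} : z ∈ intBall r ↔ ∑ i, (z i : ℝ) ^ 2 ≤ 16 * r := by
  simp only [intBall, Finset.mem_filter, Fintype.mem_piFinset, Finset.mem_Icc,
    and_iff_right_iff_imp]
  intro h i
  have h1 : (z i : ℝ) ^ 2 ≤ 16 * r :=
    (Finset.single_le_sum (f := fun i => (z i : ℝ) ^ 2) (fun _ _ => sq_nonneg _)
      (Finset.mem_univ i)).trans h
  have h2 : z i ^ 2 ≤ 16 * r := by exact_mod_cast h1
  constructor <;> nlinarith [sq_nonneg (z i - 1), sq_nonneg (z i + 1)]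

lemma sum_Icc_half_pow_natAbs (b : ℕ) :
    ∑ k ∈ Finset.Icc (-(b : ℤ)) b, (1 / 2 : ℝ) ^ k.natAbs = 3 - 2 * (1 / 2) ^ b := by
  induction b with
  | zero => norm_num
  | succ b ih =>
    have : Finset.Icc (-((b + 1 : ℕ) : ℤ)) (b + 1 : ℕ) =
        insert ((b + 1 : ℕ) : ℤ) (insert (-((b + 1 : ℕ) : ℤ)) (Finset.Icc (-(b : ℤ)) b)) := by
      ext x; simp only [Finset.mem_Icc, Finset.mem_insert]; omega
    rw [this, Finset.sum_insert, Finset.sum_insert, ih, Int.natAbs_neg, Int.natAbs_natCast,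
      pow_succ]
    · ring
    · simp
    · simp only [Finset.mem_Icc, Finset.mem_insert]; omega

/-- Each point has weight `exp (16 r - |z|²) ≥ 1`. The weight factors over coordinates, and each
one-dimensional sum is at most `3 ≤ exp 2`. -/
lemma card_intBall_le (r : ℕ) : ((intBall r).card : ℝ) ≤ Real.exp (18 * r) := by
  have hterm : ∀ k : ℤ, Real.exp (-(k : ℝ) ^ 2) ≤ (1 / 2) ^ k.natAbs := by
    intro k
    have h1 : (k.natAbs : ℝ) ≤ (k : ℝ) ^ 2 := by
      rcases eq_or_ne k 0 with rfl | hk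
      · simp
      rw [Nat.cast_natAbs]
      exact_mod_cast (by rw [← sq_abs]; exact le_self_pow₀ (Int.one_le_abs hk) two_ne_zero : |k| ≤ k ^ 2)
    calc Real.exp (-(k : ℝ) ^ 2) ≤ Real.exp (k.natAbs * (-1)) := by
          apply Real.exp_le_exp.2; linarith
      _ = Real.exp (-1) ^ k.natAbs := by rw [← Real.exp_nat_mul]
      _ ≤ _ := by
          gcongr
          rw [Real.exp_neg, one_div]
          gcongr
          have := Real.add_one_le_exp 1
          linarith
  calc ((intBall r).card : ℝ) = ∑ z ∈ intBall r, 1 := by simp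
    _ ≤ ∑ z ∈ intBall r, Real.exp (16 * r) * ∏ i, Real.exp (-(z i : ℝ) ^ 2) := by
        refine Finset.sum_le_sum fun z hz => ?_
        rw [← Real.exp_sum, ← Real.exp_add]
        apply Real.one_le_exp
        have := mem_intBall.1 hz
        simp only [Finset.sum_neg_distrib]
        linarith
    _ ≤ ∑ z ∈ Fintype.piFinset fun _ : Fin r => Finset.Icc (-((16 * r : ℕ) : ℤ)) (16 * r : ℕ),
          Real.exp (16 * r) * ∏ i, Real.exp (-(z i : ℝ) ^ 2) := by
        refine Finset.sum_le_sum_of_subset_of_nonneg ?_ fun _ _ _ => by positivity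
        push_cast
        exact Finset.filter_subset _ _
    _ = Real.exp (16 * r) *
        ∏ _i : Fin r, ∑ k ∈ Finset.Icc (-((16 * r : ℕ) : ℤ)) (16 * r : ℕ),
          Real.exp (-(k : ℝ) ^ 2) := by
        rw [← Finset.mul_sum, Finset.prod_univ_sum]
    _ ≤ Real.exp (16 * r) * ∏ _i : Fin r, Real.exp 2 := by
        gcongr with i
        refine (Finset.sum_le_sum fun k _ => hterm k).trans ?_
        rw [sum_Icc_half_pow_natAbs]
        have := Real.add_one_le_exp 2
        have : (0 : ℝ) ≤ (1 / 2) ^ (16 * r) := by positivity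
        linarith
    _ = _ := by
        rw [Finset.prod_const, Finset.card_univ, Fintype.card_fin, ← Real.exp_nat_mul,
          ← Real.exp_add]
        congr 1; ring

/-- An integer vector as a vector of Euclidean space. -/
noncomputable def intVec {r : ℕ} (z : Fin r → ℤ) : EuclideanSpace ℝ (Fin r) :=
  WithLp.toLp 2 fun i => (z i : ℝ)

/-- Rounding towards zero never lengthens a vector, so net points stay in the ball. -/
lemma exists_int_near (a : ℝ) : ∃ k : ℤ, (a - k) ^ 2 ≤ 1 ∧ (k : ℝ) ^ 2 ≤ a ^ 2 := by
  rcases le_total 0 a with h | h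
  · have h1 := Int.floor_le a
    have h2 := Int.lt_floor_add_one a
    have h3 : (0 : ℝ) ≤ ⌊a⌋ := by exact_mod_cast Int.floor_nonneg.2 h
    exact ⟨⌊a⌋, by nlinarith, by nlinarith⟩
  · have h1 := Int.le_ceil a
    have h2 := Int.ceil_lt_add_one a
    have h3 : (⌈a⌉ : ℝ) ≤ 0 := by exact_mod_cast Int.ceil_le.2 (by simpa using h)
    exact ⟨⌈a⌉, by nlinarith, by nlinarith⟩

lemma exists_intBall_near {r : ℕ} (hr : 0 < r) (x : EuclideanSpace ℝ (Fin r)) (hx : ‖x‖ = 1) :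
    ∃ z ∈ intBall r, ‖x - (4 * √r)⁻¹ • intVec z‖ ≤ 1 / 4 ∧ ‖(4 * √r)⁻¹ • intVec z‖ ≤ 1 := by
  have hr' : (0 : ℝ) < r := by exact_mod_cast hr
  have hs : (4 * √r) ^ 2 = 16 * r := by rw [mul_pow, Real.sq_sqrt hr'.le]; norm_num
  have hs0 : 0 < 4 * √r := by positivity
  choose z hz1 hz2 using fun i => exists_int_near (4 * √r * x i)
  have hx2 : ∑ i, x i ^ 2 = 1 := by rw [← EuclideanSpace.real_norm_sq_eq, hx, one_pow]
  have hz : ∑ i, (z i : ℝ) ^ 2 ≤ 16 * r := by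
    calc ∑ i, (z i : ℝ) ^ 2 ≤ ∑ i, (4 * √r * x i) ^ 2 := Finset.sum_le_sum fun i _ => hz2 i
      _ = 16 * r := by
        simp only [mul_pow _ (x _), ← Finset.mul_sum, hx2, hs, mul_one]
  refine ⟨z, mem_intBall.2 hz, ?_, ?_⟩
  · refine abs_le_of_sq_le_sq' ?_ (by norm_num) |>.2
    rw [EuclideanSpace.real_norm_sq_eq]
    calc ∑ i, (x - (4 * √r)⁻¹ • intVec z) i ^ 2
        = ∑ i, ((4 * √r) ^ 2)⁻¹ * (4 * √r * x i - z i) ^ 2 := by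
          refine Finset.sum_congr rfl fun i _ => ?_
          simp only [PiLp.sub_apply, PiLp.smul_apply, smul_eq_mul, intVec]
          rw [← inv_pow, ← mul_pow]
          congr 1
          field_simp
      _ ≤ ∑ i : Fin r, ((4 * √r) ^ 2)⁻¹ * 1 := by
          gcongr with i; exact hz1 i
      _ = (1 / 4) ^ 2 := by
          simp only [hs, Finset.sum_const, Finset.card_univ, Fintype.card_fin, nsmul_eq_mul]
          field_simp
          norm_num
  · refine abs_le_of_sq_le_sq' ?_ (by norm_num) |>.2
    rw [EuclideanSpace.real_norm_sq_eq]
    calc ∑ i, ((4 * √r)⁻¹ • intVec z) i ^ 2 = (16 * r : ℝ)⁻¹ * ∑ i, (z i : ℝ) ^ 2 := by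
          simp only [PiLp.smul_apply, smul_eq_mul, intVec, mul_pow, inv_pow, ← hs, Finset.mul_sum]
      _ ≤ (16 * r : ℝ)⁻¹ * (16 * r) := by gcongr
      _ = 1 ^ 2 := by field_simp

/-- The operator norm is nearly attained on integer points. -/
lemma exists_opNorm_le_intBall {r : ℕ} (hr : 0 < r)
    (T : EuclideanSpace ℝ (Fin r) →L[ℝ] EuclideanSpace ℝ (Fin r)) :
    ∃ z ∈ intBall r, ∃ z' ∈ intBall r, ‖T‖ ≤ 1 / (8 * r) * inner ℝ (intVec z) (T (intVec z')) := by
  have hr' : (0 : ℝ) < r := by exact_mod_cast hr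
  have h0 : (0 : Fin r → ℤ) ∈ intBall r := mem_intBall.2 (by simp)
  obtain ⟨⟨z, z'⟩, hz, hmax⟩ := Finset.exists_max_image (intBall r ×ˢ intBall r)
    (fun y => inner ℝ (intVec y.1) (T (intVec y.2))) ⟨(0, 0), Finset.mk_mem_product h0 h0⟩
  rw [Finset.mem_product] at hz
  refine ⟨z, hz.1, z', hz.2, ?_⟩
  set S : ℝ := inner ℝ (intVec z) (T (intVec z')) with hS
  have hS0 : 0 ≤ S := by
    have := hmax (0, 0) (Finset.mk_mem_product h0 h0)
    have h1 : intVec (0 : Fin r → ℤ) = 0 := by ext i; simp [intVec]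
    simpa [h1] using this
  -- Moving each of the two unit vectors to the net, at distance `1/4`, loses `‖T‖ / 4`; the total
  -- loss is absorbed on the left.
  have hT : ‖T‖ ≤ 1 / (16 * r) * S + ‖T‖ / 2 := by
    refine ContinuousLinearMap.opNorm_le_of_unit_norm (by positivity) fun x hx => ?_
    rcases eq_or_ne (T x) 0 with h | h
    · rw [h, norm_zero]; positivity
    have hn : ‖T x‖ ≠ 0 := norm_ne_zero_iff.2 h
    set u := ‖T x‖⁻¹ • T x with hu
    have hu1 : ‖u‖ = 1 := by rw [hu, norm_smul, norm_inv, norm_norm, inv_mul_cancel₀ hn]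
    have huT : inner ℝ u (T x) = ‖T x‖ := by
      rw [hu, real_inner_smul_left, real_inner_self_eq_norm_sq, sq, inv_mul_cancel_left₀ hn]
    obtain ⟨a, ha, ha1, ha2⟩ := exists_intBall_near hr u hu1
    obtain ⟨b, hb, hb1, hb2⟩ := exists_intBall_near hr x hx
    set a' := (4 * √r)⁻¹ • intVec a with ha'
    set b' := (4 * √r)⁻¹ • intVec b with hb'
    have h1 : inner ℝ a' (T b') ≤ 1 / (16 * r) * S := by
      rw [ha', hb', map_smul, real_inner_smul_left, real_inner_smul_right, ← mul_assoc,
        ← mul_inv, ← sq, mul_pow, Real.sq_sqrt hr'.le, one_div]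
      norm_num only
      gcongr
      exact hmax (a, b) (Finset.mk_mem_product ha hb)
    have h2 : inner ℝ (u - a') (T b') ≤ ‖T‖ / 4 := by
      calc inner ℝ (u - a') (T b') ≤ ‖u - a'‖ * ‖T b'‖ := real_inner_le_norm _ _
        _ ≤ 1 / 4 * (‖T‖ * 1) := by
          gcongr
          exact (T.le_opNorm _).trans (by gcongr)
        _ = _ := by ring
    have h3 : inner ℝ u (T (x - b')) ≤ ‖T‖ / 4 := by
      calc inner ℝ u (T (x - b')) ≤ ‖u‖ * ‖T (x - b')‖ := real_inner_le_norm _ _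
        _ ≤ 1 * (‖T‖ * (1 / 4)) := by
          gcongr
          · exact hu1.le
          · exact (T.le_opNorm _).trans (by gcongr)
        _ = _ := by ring
    have h4 : inner ℝ u (T x) = inner ℝ a' (T b') + inner ℝ (u - a') (T b') +
        inner ℝ u (T (x - b')) := by
      rw [map_sub, inner_sub_left, inner_sub_right]; ring
    rw [← huT, h4]
    linarith
  have : 1 / (8 * r) * S = 2 * (1 / (16 * r) * S) := by field_simp; ring
  linarith

/-! ### Norm of the dice matrix and the number of doubled walks. -/

section L2Norm

open scoped Matrix.Norms.L2Operator

lemma single_le_sum_sum {α β : Type*} {s : Finset α} {t : Finset β} {g : α → β → ℝ}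
    (hg : ∀ a b, 0 ≤ g a b) {a : α} {b : β} (ha : a ∈ s) (hb : b ∈ t) :
    g a b ≤ ∑ a ∈ s, ∑ b ∈ t, g a b :=
  (Finset.single_le_sum (fun b _ => hg a b) hb).trans
    (Finset.single_le_sum (f := fun a => ∑ b ∈ t, g a b)
      (fun a _ => Finset.sum_nonneg fun b _ => hg a b) ha)

/-- The maximum over the net is bounded by the sum over pairs of net points. For one pair,
`sum_exp_die_le` and independence give `exp (18 t²)`; the number of pairs gives `exp (36 r)`. -/
lemma sum_exp_norm_dieMatrix_le {r : ℕ} (hr : 0 < r) {t : ℝ} (ht : 0 ≤ t) :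
    ∑ ω : Fin r × Fin r → Fin 3, Real.exp (t * ‖dieMatrix ω‖) ≤
      3 ^ (r * r) * Real.exp (36 * r + 18 * t ^ 2) := by
  have hr' : (0 : ℝ) < r := by exact_mod_cast hr
  have h1 : ∀ ω : Fin r × Fin r → Fin 3, Real.exp (t * ‖dieMatrix ω‖) ≤
      ∑ z ∈ intBall r, ∑ z' ∈ intBall r,
        ∏ x, Real.exp (t / (8 * r) * z x.1 * z' x.2 * dieValue (ω x)) := by
    intro ω
    obtain ⟨z, hz, z', hz', h⟩ := exists_opNorm_le_intBall hr
      (Matrix.toEuclideanCLM (n := Fin r) (𝕜 := ℝ) (dieMatrix ω))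
    rw [← Matrix.cstar_norm_def, Matrix.inner_toEuclideanCLM] at h
    have h2 : Real.exp (t * ‖dieMatrix ω‖) ≤
        ∏ x, Real.exp (t / (8 * r) * z x.1 * z' x.2 * dieValue (ω x)) := by
      rw [← Real.exp_sum, Real.exp_le_exp]
      calc t * ‖dieMatrix ω‖ ≤ t * _ := mul_le_mul_of_nonneg_left h ht
        _ = _ := by
          rw [Fintype.sum_prod_type]
          simp only [dotProduct, Matrix.mulVec, intVec, dieMatrix, Matrix.of_apply,
            Finset.mul_sum]
          refine Finset.sum_congr rfl fun i _ => Finset.sum_congr rfl fun j _ => ?_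
          ring
    exact h2.trans (single_le_sum_sum
      (g := fun z z' => ∏ x, Real.exp (t / (8 * r) * z x.1 * z' x.2 * dieValue (ω x)))
      (fun _ _ => Finset.prod_nonneg fun _ _ => (Real.exp_pos _).le) hz hz')
  have h3 : ∀ z ∈ intBall r, ∀ z' ∈ intBall r, ∑ ω : Fin r × Fin r → Fin 3,
      ∏ x, Real.exp (t / (8 * r) * z x.1 * z' x.2 * dieValue (ω x)) ≤
      3 ^ (r * r) * Real.exp (18 * t ^ 2) := by
    intro z hz z' hz'
    rw [sum_prod_die fun (x : Fin r × Fin r) c => Real.exp (t / (8 * r) * z x.1 * z' x.2 * dieValue c)]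
    calc _ ≤ ∏ x : Fin r × Fin r,
          (3 * Real.exp (9 / 2 * (t / (8 * r) * z x.1 * z' x.2) ^ 2)) :=
          Finset.prod_le_prod (fun _ _ => by positivity) fun x _ => sum_exp_die_le _
      _ = 3 ^ (r * r) * Real.exp (9 / 2 * (t / (8 * r)) ^ 2 *
          ((∑ i, (z i : ℝ) ^ 2) * ∑ j, (z' j : ℝ) ^ 2)) := by
          rw [Finset.prod_mul_distrib, Finset.prod_const, Finset.card_univ, Fintype.card_prod,
            Fintype.card_fin, ← Real.exp_sum, Fintype.sum_prod_type, Finset.sum_mul_sum]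
          simp only [Finset.mul_sum]
          congr 2
          refine Finset.sum_congr rfl fun i _ => Finset.sum_congr rfl fun j _ => ?_
          ring
      _ ≤ 3 ^ (r * r) * Real.exp (9 / 2 * (t / (8 * r)) ^ 2 * ((16 * r) * (16 * r))) := by
          gcongr
          · exact mem_intBall.1 hz
          · exact mem_intBall.1 hz'
      _ = _ := by
          congr 2
          field_simp
          ring
  calc _ ≤ ∑ ω : Fin r × Fin r → Fin 3, ∑ z ∈ intBall r, ∑ z' ∈ intBall r,
        ∏ x, Real.exp (t / (8 * r) * z x.1 * z' x.2 * dieValue (ω x)) :=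
        Finset.sum_le_sum fun ω _ => h1 ω
    _ = ∑ z ∈ intBall r, ∑ z' ∈ intBall r, ∑ ω : Fin r × Fin r → Fin 3,
        ∏ x, Real.exp (t / (8 * r) * z x.1 * z' x.2 * dieValue (ω x)) := by
        rw [Finset.sum_comm]
        exact Finset.sum_congr rfl fun z _ => Finset.sum_comm
    _ ≤ ∑ z ∈ intBall r, ∑ z' ∈ intBall r, 3 ^ (r * r) * Real.exp (18 * t ^ 2) :=
        Finset.sum_le_sum fun z hz => Finset.sum_le_sum fun z' hz' => h3 z hz z' hz'
    _ = (intBall r).card * ((intBall r).card * (3 ^ (r * r) * Real.exp (18 * t ^ 2))) := by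
        simp only [Finset.sum_const, nsmul_eq_mul]
    _ ≤ Real.exp (18 * r) * (Real.exp (18 * r) * (3 ^ (r * r) * Real.exp (18 * t ^ 2))) := by
        gcongr <;> exact card_intBall_le r
    _ = _ := by
        rw [show (36 * r + 18 * t ^ 2 : ℝ) = 18 * r + (18 * r + 18 * t ^ 2) by ring,
          Real.exp_add, Real.exp_add]
        ring

lemma Matrix.norm_transpose_l2 {I J : Type*} [Fintype I] [Fintype J] [DecidableEq I]
    [DecidableEq J] (A : Matrix I J ℝ) : ‖A.transpose‖ = ‖A‖ := by
  rw [← Matrix.conjTranspose_eq_transpose_of_trivial, Matrix.l2_opNorm_conjTranspose]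

lemma Matrix.diag_le_l2_opNorm {I : Type*} [Fintype I] [DecidableEq I] (A : Matrix I I ℝ)
    (i : I) : A i i ≤ ‖A‖ := by
  have h := real_inner_le_norm (EuclideanSpace.single i (1 : ℝ))
    (Matrix.toEuclideanCLM (n := I) (𝕜 := ℝ) A (EuclideanSpace.single i (1 : ℝ)))
  rw [Matrix.inner_toEuclideanCLM] at h
  have h2 := (Matrix.toEuclideanCLM (n := I) (𝕜 := ℝ) A).le_opNorm (EuclideanSpace.single i 1)
  simp only [PiLp.norm_single, norm_one, one_mul, mul_one] at h h2
  rw [Matrix.cstar_norm_def]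
  refine le_trans (le_of_eq ?_) (h.trans h2)
  simp

lemma Matrix.trace_mul_transpose_pow_le {I J : Type*} [Fintype I] [Fintype J] [DecidableEq I]
    [DecidableEq J] (A : Matrix I J ℝ) {m : ℕ} (hm : 0 < m) :
    ((A * A.transpose) ^ m).trace ≤ Fintype.card I * (‖A‖ ^ 2) ^ m := by
  have h : ‖(A * A.transpose) ^ m‖ ≤ (‖A‖ ^ 2) ^ m := by
    refine (norm_pow_le' _ hm).trans ?_
    gcongr
    refine (Matrix.l2_opNorm_mul _ _).trans ?_
    rw [Matrix.norm_transpose_l2, sq]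
  calc ((A * A.transpose) ^ m).trace ≤ ∑ _i : I, (‖A‖ ^ 2) ^ m :=
        Finset.sum_le_sum fun i _ => (Matrix.diag_le_l2_opNorm _ i).trans h
    _ = _ := by simp

/-- At `t = √r` the exponential moment is `exp (54 r)`. The bound `x ^ (2r) / (2r)! ≤ exp x` turns
it into a moment of order `2r`, from which lower ones follow. -/
lemma sum_norm_dieMatrix_pow_le {m r : ℕ} (hr : 0 < r) (hmr : m ≤ r) :
    ∑ ω : Fin r × Fin r → Fin 3, (‖dieMatrix ω‖ ^ 2) ^ m ≤
      3 ^ (r * r) * (2 * (4 * Real.exp 54 * r) ^ m) := by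
  have hr' : (0 : ℝ) < r := by exact_mod_cast hr
  have hsq : √(r : ℝ) ^ 2 = r := Real.sq_sqrt hr'.le
  set A : ℝ := 4 * Real.exp 54 with hA
  have hA0 : 0 < A := by positivity
  have h1 : ∀ ω : Fin r × Fin r → Fin 3, (‖dieMatrix ω‖ ^ 2 / r) ^ r ≤
      4 ^ r * Real.exp (√r * ‖dieMatrix ω‖) := by
    intro ω
    have h2 := Real.pow_div_factorial_le_exp (√r * ‖dieMatrix ω‖) (by positivity) (2 * r)
    rw [div_le_iff₀ (by positivity), pow_mul, mul_pow, hsq] at h2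
    have h3 : ((2 * r).factorial : ℝ) ≤ (4 * (r : ℝ) ^ 2) ^ r := by
      calc ((2 * r).factorial : ℝ) ≤ ((2 * r : ℕ) : ℝ) ^ (2 * r) := by
            exact_mod_cast Nat.factorial_le_pow (2 * r)
        _ = _ := by rw [pow_mul]; push_cast; ring
    have h4 : ((r : ℝ) * ‖dieMatrix ω‖ ^ 2) ^ r = (r ^ 2 : ℝ) ^ r * (‖dieMatrix ω‖ ^ 2 / r) ^ r := by
      rw [← mul_pow]; congr 1; field_simp
    rw [h4] at h2
    have h5 : (r ^ 2 : ℝ) ^ r * (‖dieMatrix ω‖ ^ 2 / r) ^ r ≤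
        (r ^ 2 : ℝ) ^ r * (4 ^ r * Real.exp (√r * ‖dieMatrix ω‖)) := by
      calc _ ≤ _ := h2
        _ ≤ Real.exp (√r * ‖dieMatrix ω‖) * (4 * (r : ℝ) ^ 2) ^ r := by gcongr
        _ = _ := by rw [mul_pow]; ring
    exact le_of_mul_le_mul_left h5 (by positivity)
  have h6 : ∑ ω : Fin r × Fin r → Fin 3, (‖dieMatrix ω‖ ^ 2 / r) ^ r ≤ 3 ^ (r * r) * A ^ r := by
    calc _ ≤ ∑ ω : Fin r × Fin r → Fin 3, 4 ^ r * Real.exp (√r * ‖dieMatrix ω‖) :=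
          Finset.sum_le_sum fun ω _ => h1 ω
      _ ≤ 4 ^ r * (3 ^ (r * r) * Real.exp (36 * r + 18 * √r ^ 2)) := by
          rw [← Finset.mul_sum]
          gcongr
          exact sum_exp_norm_dieMatrix_le hr (by positivity)
      _ = _ := by
          rw [hsq, hA, mul_pow, ← Real.exp_nat_mul, show (36 * r + 18 * r : ℝ) = r * 54 by ring]
          ring
  -- Passage from order `r` to order `m ≤ r`, by comparing `x` with `A`.
  have h7 : ∀ x : ℝ, 0 ≤ x → A ^ (r - m) * x ^ m ≤ A ^ r + x ^ r := by
    intro x hx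
    rcases le_total x A with h | h
    · calc A ^ (r - m) * x ^ m ≤ A ^ (r - m) * A ^ m := by gcongr
        _ = A ^ r := by rw [← pow_add, Nat.sub_add_cancel hmr]
        _ ≤ _ := by have := pow_nonneg hx r; linarith
    · calc A ^ (r - m) * x ^ m ≤ x ^ (r - m) * x ^ m := by gcongr
        _ = x ^ r := by rw [← pow_add, Nat.sub_add_cancel hmr]
        _ ≤ _ := by have := pow_nonneg hA0.le r; linarith
  have h8 : A ^ (r - m) * ∑ ω : Fin r × Fin r → Fin 3, (‖dieMatrix ω‖ ^ 2 / r) ^ m ≤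
      A ^ (r - m) * (3 ^ (r * r) * (2 * A ^ m)) := by
    calc _ ≤ ∑ ω : Fin r × Fin r → Fin 3, (A ^ r + (‖dieMatrix ω‖ ^ 2 / r) ^ r) := by
          rw [Finset.mul_sum]
          exact Finset.sum_le_sum fun ω _ => h7 _ (by positivity)
      _ ≤ 3 ^ (r * r) * A ^ r + 3 ^ (r * r) * A ^ r := by
          rw [Finset.sum_add_distrib]
          gcongr
          simp
      _ = 3 ^ (r * r) * (2 * (A ^ (r - m) * A ^ m)) := by
          rw [← pow_add, Nat.sub_add_cancel hmr]; ring
      _ = _ := by ring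
  have h9 := le_of_mul_le_mul_left h8 (by positivity)
  calc _ = (r : ℝ) ^ m * ∑ ω : Fin r × Fin r → Fin 3, (‖dieMatrix ω‖ ^ 2 / r) ^ m := by
        rw [Finset.mul_sum]
        refine Finset.sum_congr rfl fun ω _ => ?_
        rw [← mul_pow, mul_div_cancel₀ _ hr'.ne']
    _ ≤ (r : ℝ) ^ m * (3 ^ (r * r) * (2 * A ^ m)) := by gcongr
    _ = _ := by rw [mul_pow]; ring

open Classical in
lemma card_doubledWalk_le {m r : ℕ} (hm : 0 < m) (hmr : m ≤ r) :
    ∑ w : Fin (m + 1) → Fin r, ∑ v : Fin m → Fin r, (if IsDoubledWalk w v then (1 : ℝ) else 0) ≤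
      2 * r * (4 * Real.exp 54 * r) ^ m := by
  have h1 := card_doubledWalk_le_sum_trace m r
  have h2 : ∑ ω : Fin r × Fin r → Fin 3, ((dieMatrix ω * (dieMatrix ω).transpose) ^ m).trace ≤
      r * (3 ^ (r * r) * (2 * (4 * Real.exp 54 * r) ^ m)) := by
    calc _ ≤ ∑ ω : Fin r × Fin r → Fin 3, r * (‖dieMatrix ω‖ ^ 2) ^ m := by
          refine Finset.sum_le_sum fun ω _ => ?_
          simpa using Matrix.trace_mul_transpose_pow_le (dieMatrix ω) hm
      _ ≤ _ := by
          rw [← Finset.mul_sum]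
          gcongr
          exact sum_norm_dieMatrix_pow_le (hm.trans_le hmr) hmr
  refine le_of_mul_le_mul_left ((h1.trans h2).trans (le_of_eq ?_))
    (by positivity : (0 : ℝ) < 3 ^ (r * r))
  ring

end L2Norm

/-! ### The trace method for random matrices. -/

section L2Norm

open scoped Matrix.Norms.L2Operator

lemma Matrix.l2_opNorm_sq_le_sum_sq {I J : Type*} [Fintype I] [Fintype J] [DecidableEq I]
    [DecidableEq J] (A : Matrix I J ℝ) : ‖A‖ ^ 2 ≤ ∑ i, ∑ j, A i j ^ 2 := by
  have h0 : 0 ≤ ∑ i, ∑ j, A i j ^ 2 := by positivity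
  rw [← Real.le_sqrt (norm_nonneg _) h0, Matrix.l2_opNorm_def]
  refine ContinuousLinearMap.opNorm_le_bound _ (Real.sqrt_nonneg _) fun x => ?_
  refine abs_le_of_sq_le_sq' ?_ (by positivity) |>.2
  rw [mul_pow, Real.sq_sqrt h0, EuclideanSpace.real_norm_sq_eq, EuclideanSpace.real_norm_sq_eq,
    Finset.sum_mul]
  refine Finset.sum_le_sum fun i _ => ?_
  exact Finset.sum_mul_sq_le_sq_mul_sq Finset.univ (fun j => A i j) x

lemma largestSingularValue_le_norm {N n : ℕ} (hn : 0 < n) (A : Matrix (Fin N) (Fin n) ℝ) :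
    largestSingularValue A ≤ ‖A‖ := by
  have h := (Matrix.toEuclideanLin A).hasEigenvalue_adjoint_comp_self_sq_singularValues
    (n := 0) (by simpa using hn)
  obtain ⟨x, hx⟩ := h.exists_hasEigenvector
  have hx0 : 0 < ‖x‖ := norm_pos_iff.2 hx.2
  have h1 : ‖Matrix.toEuclideanLin A x‖ ^ 2 = (largestSingularValue A * ‖x‖) ^ 2 := by
    have := hx.apply_eq_smul
    rw [← real_inner_self_eq_norm_sq, ← LinearMap.adjoint_inner_right, ← LinearMap.comp_apply,
      this, real_inner_smul_right, real_inner_self_eq_norm_sq, mul_pow]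
    rfl
  have hs : 0 ≤ largestSingularValue A := LinearMap.singularValues_nonneg _ _
  have h2 : ‖Matrix.toEuclideanLin A x‖ = largestSingularValue A * ‖x‖ :=
    (sq_eq_sq₀ (norm_nonneg _) (by positivity)).1 h1
  have h3 : ‖Matrix.toEuclideanLin A x‖ ≤ ‖A‖ * ‖x‖ := A.l2_opNorm_mulVec x
  rw [h2] at h3
  exact le_of_mul_le_mul_right h3 hx0

/-- For exponents `2 ^ k` the norm of a power of a self-adjoint matrix is the power of its norm. The
last squaring is spent on the trace of `B²`, which is the squared Frobenius norm of the symmetric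
matrix `B`. -/
lemma Matrix.norm_pow_le_trace {I J : Type*} [Fintype I] [Fintype J] [DecidableEq I]
    [DecidableEq J] (A : Matrix I J ℝ) (k : ℕ) :
    (‖A‖ ^ 2) ^ 2 ^ (k + 1) ≤ ((A * A.transpose) ^ 2 ^ (k + 1)).trace := by
  have hH : (A * A.transpose).transpose = A * A.transpose := by
    rw [Matrix.transpose_mul, Matrix.transpose_transpose]
  have hsa : IsSelfAdjoint (A * A.transpose) := by
    rw [IsSelfAdjoint, Matrix.star_eq_conjTranspose,
      Matrix.conjTranspose_eq_transpose_of_trivial, hH]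
  have h1 : ‖A * A.transpose‖ = ‖A‖ ^ 2 := by
    have := Matrix.l2_opNorm_conjTranspose_mul_self A.transpose
    rw [Matrix.conjTranspose_eq_transpose_of_trivial, Matrix.transpose_transpose,
      Matrix.norm_transpose_l2] at this
    rw [this, sq]
  set B := (A * A.transpose) ^ 2 ^ k with hB
  have h2 : ‖B‖ = (‖A‖ ^ 2) ^ 2 ^ k := by rw [hB, hsa.norm_pow_two_pow, h1]
  have hBT : B.transpose = B := by rw [hB, Matrix.transpose_pow, hH]
  rw [pow_succ 2 k, pow_mul, pow_mul, ← h2, ← hB, sq B]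
  refine (Matrix.l2_opNorm_sq_le_sum_sq B).trans (le_of_eq ?_)
  simp only [Matrix.trace, Matrix.diag_apply, Matrix.mul_apply]
  refine Finset.sum_congr rfl fun i _ => Finset.sum_congr rfl fun j _ => ?_
  rw [sq]
  congr 1
  exact congrFun (congrFun hBT j) i

/-- Bounds on the trace moments of a random matrix whose entries have multiplicative joint
moments, are centered and have small normalized higher moments. -/
lemma integral_trace_le {Ω : Type*} [MeasurableSpace Ω] {P : Measure Ω}
    {I J : Type*} [Fintype I] [Fintype J] [DecidableEq I] [DecidableEq J] {m r : ℕ}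
    (hJ : 0 < Fintype.card J) (hJI : Fintype.card J ≤ Fintype.card I) (hm : 0 < m)
    (hr : 2 * (m + 1) ^ 2 ≤ r) (hrI : r ≤ Fintype.card I) (Y : I → J → Ω → ℝ) {D : ℝ}
    (hD : 0 ≤ D) (hint : ∀ k : I × J → ℕ, Integrable (fun ω => ∏ x, Y x.1 x.2 ω ^ k x) P)
    (hprod : ∀ k : I × J → ℕ, ∫ ω, ∏ x, Y x.1 x.2 ω ^ k x ∂P = ∏ x, ∫ ω, Y x.1 x.2 ω ^ k x ∂P)
    (h0 : ∀ i j, ∫ ω, Y i j ω ^ 0 ∂P = 1) (h1 : ∀ i j, ∫ ω, Y i j ω ^ 1 ∂P = 0)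
    (h2 : ∀ i j k, 2 ≤ k → |∫ ω, Y i j ω ^ k ∂P| ≤ (r : ℝ) / Fintype.card I * D ^ k) :
    Integrable (fun ω => ((Matrix.of (fun i j => Y i j ω) *
      (Matrix.of (fun i j => Y i j ω)).transpose) ^ m).trace) P ∧
    ∫ ω, ((Matrix.of (fun i j => Y i j ω) *
      (Matrix.of (fun i j => Y i j ω)).transpose) ^ m).trace ∂P ≤
      8 * Fintype.card I * (4 * Real.exp 54 * r * D ^ 2) ^ m := by
  classical
  have hr0 : (0 : ℝ) < r := by
    have : 0 < r := lt_of_lt_of_le (by positivity) hr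
    exact_mod_cast this
  have hterm : ∀ (w : Fin (m + 1) → I) (v : Fin m → J) (ω : Ω),
      (if w 0 = w (Fin.last m) then ∏ e, Y (walkEdge w v e).1 (walkEdge w v e).2 ω else 0) =
      if w 0 = w (Fin.last m) then
        ∏ x : I × J, Y x.1 x.2 ω ^ (Finset.univ.filter fun e => walkEdge w v e = x).card else 0 := by
    intro w v ω
    rw [← prod_comp_eq_prod_pow (walkEdge w v) fun x => Y x.1 x.2 ω]
  have hint' : ∀ (w : Fin (m + 1) → I) (v : Fin m → J), Integrable (fun ω =>
      if w 0 = w (Fin.last m) then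
        ∏ x : I × J, Y x.1 x.2 ω ^ (Finset.univ.filter fun e => walkEdge w v e = x).card
      else 0) P := by
    intro w v
    split_ifs
    · exact hint _
    · exact integrable_zero _ _ _
  simp only [Matrix.trace_mul_transpose_pow, Matrix.of_apply, hterm]
  refine ⟨integrable_finsetSum _ fun w _ => integrable_finsetSum _ fun v _ => hint' w v, ?_⟩
  rw [integral_finsetSum _ fun w _ => integrable_finsetSum _ fun v _ => hint' w v]
  have hstep : ∀ w : Fin (m + 1) → I, ∫ ω, ∑ v : Fin m → J, (if w 0 = w (Fin.last m) then
        ∏ x : I × J, Y x.1 x.2 ω ^ (Finset.univ.filter fun e => walkEdge w v e = x).card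
      else 0) ∂P = ∑ v : Fin m → J, if w 0 = w (Fin.last m) then
        ∏ x : I × J, (fun (x : I × J) k => ∫ ω, Y x.1 x.2 ω ^ k ∂P) x
          (Finset.univ.filter fun e => walkEdge w v e = x).card else 0 := by
    intro w
    rw [integral_finsetSum _ fun v _ => hint' w v]
    refine Finset.sum_congr rfl fun v _ => ?_
    split_ifs
    · exact hprod _
    · simp
  simp only [hstep]
  have h3 := sum_walks_moments_le hJ hJI hr hrI
    (μ := fun (x : I × J) k => ∫ ω, Y x.1 x.2 ω ^ k ∂P) hD (fun x => h0 _ _) (fun x => h1 _ _)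
    (fun x k hk => h2 _ _ k hk)
  have h4 := card_doubledWalk_le hm (show m ≤ r by nlinarith)
  calc _ ≤ _ := h3
    -- The factor `r` in the walk count cancels the `1/r` left over from the extra vertex.
    _ ≤ 4 * D ^ (2 * m) * (Fintype.card I / r) * (2 * r * (4 * Real.exp 54 * r) ^ m) := by
        gcongr
    _ = _ := by
        rw [mul_pow _ (D ^ 2), ← pow_mul]
        field_simp
        ring

end L2Norm

/-! ### Moments of the mask and truncation of the entries. -/

section Mask

variable {Ω : Type*} [MeasurableSpace Ω] {P : Measure Ω} {p : unitInterval}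

lemma ae_mem_zero_one_of_hasLaw {ξ : Ω → ℝ} (h : HasLaw ξ (bernoulliMeasure 1 0 p) P) :
    ∀ᵐ ω ∂P, ξ ω = 1 ∨ ξ ω = 0 := by
  have hs : MeasurableSet {x : ℝ | x = 1 ∨ x = 0} :=
    (measurableSet_singleton 1).union (measurableSet_singleton 0)
  have h1 : ∀ᵐ x ∂(bernoulliMeasure (1 : ℝ) 0 p), x = 1 ∨ x = 0 := by
    rw [bernoulliMeasure_def]
    refine ae_add_measure_iff.2 ⟨?_, ?_⟩ <;>
    · refine Measure.ae_smul_measure ?_ _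
      rw [ae_dirac_iff hs]
      simp
  rw [← h.map_eq] at h1
  exact ae_of_ae_map h.aemeasurable h1

lemma integral_mask_pow {ξ : Ω → ℝ} (h : HasLaw ξ (bernoulliMeasure 1 0 p) P) {k : ℕ}
    (hk : k ≠ 0) : ∫ ω, ξ ω ^ k ∂P = p := by
  have := h.integral_comp (f := fun x : ℝ => x ^ k) (by fun_prop)
  simp only [Function.comp_def] at this
  rw [this, integral_bernoulliMeasure]
  simp [hk]

end Mask

section Truncation

variable {Ω : Type*} [MeasurableSpace Ω] {P : Measure Ω} [IsProbabilityMeasure P]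

/-- Truncation of a real number at level `T`. -/
noncomputable def truncate (T x : ℝ) : ℝ := if |x| ≤ T then x else 0

lemma measurable_truncate (T : ℝ) : Measurable (truncate T) :=
  Measurable.ite (measurableSet_le (by fun_prop) (by fun_prop)) measurable_id measurable_const

lemma abs_truncate_le {T : ℝ} (hT : 0 ≤ T) (x : ℝ) : |truncate T x| ≤ T := by
  unfold truncate; split_ifs with h
  · exact h
  · simpa using hT

lemma truncate_sq_le (T x : ℝ) : truncate T x ^ 2 ≤ x ^ 2 := by
  unfold truncate; split_ifs
  · rfl
  · simpa using sq_nonneg x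

lemma abs_sub_truncate_le {T s : ℝ} (hT : 0 < T) (hs : 0 ≤ s) (x : ℝ) :
    |x - truncate T x| ≤ |x| ^ (1 + s) / T ^ s := by
  have hTs : 0 < T ^ s := Real.rpow_pos_of_pos hT s
  unfold truncate; split_ifs with h
  · simp only [sub_self, abs_zero]
    positivity
  · push Not at h
    have hx : 0 < |x| := hT.trans h
    rw [sub_zero, le_div_iff₀ hTs, Real.rpow_add hx, Real.rpow_one]
    gcongr

variable {X : Ω → ℝ} {T s M : ℝ}

lemma integrable_truncate (hX : Measurable X) (hT : 0 ≤ T) :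
    Integrable (fun ω => truncate T (X ω)) P :=
  Integrable.of_bound ((measurable_truncate T).comp hX).aestronglyMeasurable T
    (Filter.Eventually.of_forall fun _ => abs_truncate_le hT _)

/-- As `X` is centred, the truncated mean is minus the mean of the tail, where `|X| > T` gains the
factor `(|X|/T) ^ s`. -/
lemma abs_integral_truncate_le (hX : Measurable X) (hX1 : Integrable X P) (hT : 0 < T)
    (hs : 0 ≤ s) (h0 : ∫ ω, X ω ∂P = 0) (hint : Integrable (fun ω => |X ω| ^ (1 + s)) P)
    (hM : ∫ ω, |X ω| ^ (1 + s) ∂P ≤ M) : |∫ ω, truncate T (X ω) ∂P| ≤ M / T ^ s := by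
  have h1 : ∫ ω, truncate T (X ω) ∂P = -∫ ω, (X ω - truncate T (X ω)) ∂P := by
    rw [integral_sub hX1 (integrable_truncate hX hT.le), h0]; ring
  have hTs : 0 < T ^ s := Real.rpow_pos_of_pos hT s
  rw [h1, abs_neg]
  calc |∫ ω, (X ω - truncate T (X ω)) ∂P| ≤ ∫ ω, |X ω - truncate T (X ω)| ∂P :=
        abs_integral_le_integral_abs
    _ ≤ ∫ ω, |X ω| ^ (1 + s) / T ^ s ∂P :=
        integral_mono (hX1.sub (integrable_truncate hX hT.le)).abs (hint.div_const _)
          fun ω => abs_sub_truncate_le hT hs _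
    _ = (∫ ω, |X ω| ^ (1 + s) ∂P) / T ^ s := integral_div _ _
    _ ≤ _ := by gcongr

lemma integral_truncate_sub_sq_le (hX : Measurable X) (hX2 : Integrable (fun ω => X ω ^ 2) P)
    (hT : 0 ≤ T) :
    ∫ ω, (truncate T (X ω) - ∫ ω', truncate T (X ω') ∂P) ^ 2 ∂P ≤ ∫ ω, X ω ^ 2 ∂P := by
  have hZ : MemLp (fun ω => truncate T (X ω)) 2 P :=
    MemLp.of_bound ((measurable_truncate T).comp hX).aestronglyMeasurable T
      (Filter.Eventually.of_forall fun _ => abs_truncate_le hT _)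
  rw [← variance_eq_integral (X := fun ω => truncate T (X ω)) ((measurable_truncate T).comp hX).aemeasurable]
  refine (variance_le_expectation_sq hZ.1).trans ?_
  refine integral_mono hZ.integrable_sq hX2 fun ω => truncate_sq_le _ _

lemma measureReal_lt_abs_le (hT : 0 < T) (hs : 0 ≤ s)
    (hint : Integrable (fun ω => |X ω| ^ s) P) (hM : ∫ ω, |X ω| ^ s ∂P ≤ M) :
    P.real {ω | T < |X ω|} ≤ M / T ^ s := by
  have hTs : 0 < T ^ s := Real.rpow_pos_of_pos hT s
  rw [le_div_iff₀' hTs]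
  refine le_trans ?_ hM
  refine le_trans ?_ (mul_meas_ge_le_integral_of_nonneg
    (Filter.Eventually.of_forall fun ω => by positivity) hint (T ^ s))
  exact mul_le_mul_of_nonneg_left (measureReal_mono fun ω (hω : T < |X ω|) =>
    Real.rpow_le_rpow hT.le hω.le hs) hTs.le

end Truncation

/-! ### Joint moments in the dilute model. -/

section Model

variable {Ω : Type*} [MeasurableSpace Ω] {P : Measure Ω} {N n : ℕ}
  {p : unitInterval} {ξ X : Fin N → Fin n → Ω → ℝ}

lemma IsDiluteModel.integral_pow (h : IsDiluteModel P p ξ X) {g : ℝ → ℝ}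
    (hg : Measurable g) (i : Fin N) (j : Fin n) (k : ℕ) :
    ∫ ω, (ξ i j ω * g (X i j ω)) ^ k ∂P = (∫ ω, ξ i j ω ^ k ∂P) * ∫ ω, g (X i j ω) ^ k ∂P := by
  have hi : IndepFun (fun ω => ξ i j ω ^ k) (fun ω => g (X i j ω) ^ k) P :=
    h.indep_mask_entry.comp (φ := fun z : Fin N × Fin n → ℝ => z (i, j) ^ k)
      (ψ := fun z : Fin N × Fin n → ℝ => g (z (i, j)) ^ k) (by fun_prop)
      ((hg.comp (measurable_pi_apply _)).pow_const _)
  simp only [mul_pow]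
  exact hi.integral_fun_mul_eq_mul_integral
    ((h.measurable_mask _ _).pow_const _).aestronglyMeasurable
    ((hg.comp (h.measurable_entry _ _)).pow_const _).aestronglyMeasurable

lemma IsDiluteModel.integral_prod (h : IsDiluteModel P p ξ X) {g : Fin N → Fin n → ℝ → ℝ}
    (hg : ∀ i j, Measurable (g i j)) (k : Fin N × Fin n → ℕ) :
    ∫ ω, ∏ x, (ξ x.1 x.2 ω * g x.1 x.2 (X x.1 x.2 ω)) ^ k x ∂P =
      ∏ x, ∫ ω, (ξ x.1 x.2 ω * g x.1 x.2 (X x.1 x.2 ω)) ^ k x ∂P := by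
  have hm1 : Measurable fun z : Fin N × Fin n → ℝ => ∏ x, z x ^ k x := by fun_prop
  have hm2 : Measurable fun z : Fin N × Fin n → ℝ => ∏ x, g x.1 x.2 (z x) ^ k x :=
    Finset.measurable_fun_prod _ fun x _ => ((hg _ _).comp (measurable_pi_apply _)).pow_const _
  have hX : Measurable fun ω (x : Fin N × Fin n) => X x.1 x.2 ω :=
    measurable_pi_lambda _ fun x => h.measurable_entry _ _
  have hξ : Measurable fun ω (x : Fin N × Fin n) => ξ x.1 x.2 ω :=
    measurable_pi_lambda _ fun x => h.measurable_mask _ _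
  have hi : IndepFun (fun ω => ∏ x : Fin N × Fin n, ξ x.1 x.2 ω ^ k x)
      (fun ω => ∏ x : Fin N × Fin n, g x.1 x.2 (X x.1 x.2 ω) ^ k x) P :=
    h.indep_mask_entry.comp hm1 hm2
  simp only [mul_pow, Finset.prod_mul_distrib]
  rw [hi.integral_fun_mul_eq_mul_integral (hm1.comp hξ).aestronglyMeasurable
    (hm2.comp hX).aestronglyMeasurable,
    h.iIndepFun_mask.integral_fun_prod_comp (f := fun x y => y ^ k x)
      (fun x => (h.measurable_mask _ _).aemeasurable) (fun x => by fun_prop),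
    h.iIndepFun_entry.integral_fun_prod_comp (f := fun x y => g x.1 x.2 y ^ k x)
      (fun x => (h.measurable_entry _ _).aemeasurable)
      (fun x => ((hg _ _).pow_const _).aestronglyMeasurable), ← Finset.prod_mul_distrib]
  refine Finset.prod_congr rfl fun x _ => ?_
  have := h.integral_pow (hg x.1 x.2) x.1 x.2 (k x)
  simp only [mul_pow] at this
  exact this.symm

variable [IsProbabilityMeasure P]

lemma IsDiluteModel.integrable_prod (h : IsDiluteModel P p ξ X) {g : Fin N → Fin n → ℝ → ℝ}
    (hg : ∀ i j, Measurable (g i j)) {L : ℝ} (hL : ∀ i j x, |g i j x| ≤ L)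
    (k : Fin N × Fin n → ℕ) :
    Integrable (fun ω => ∏ x, (ξ x.1 x.2 ω * g x.1 x.2 (X x.1 x.2 ω)) ^ k x) P := by
  refine Integrable.of_bound (C := ∏ x, L ^ k x) ?_ ?_
  · refine Measurable.aestronglyMeasurable ?_
    refine Finset.measurable_fun_prod _ fun x _ => ?_
    exact ((h.measurable_mask _ _).mul ((hg _ _).comp (h.measurable_entry _ _))).pow_const _
  · have h1 : ∀ᵐ ω ∂P, ∀ x : Fin N × Fin n, ξ x.1 x.2 ω = 1 ∨ ξ x.1 x.2 ω = 0 :=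
      ae_all_iff.2 fun x => ae_mem_zero_one_of_hasLaw (h.law_mask x.1 x.2)
    filter_upwards [h1] with ω hω
    rw [Real.norm_eq_abs, Finset.abs_prod]
    refine Finset.prod_le_prod (fun _ _ => abs_nonneg _) fun x _ => ?_
    rw [abs_pow]
    gcongr
    rcases hω x with h2 | h2 <;> rw [h2]
    · rw [one_mul]; exact hL _ _ _
    · rw [zero_mul, abs_zero]; exact (abs_nonneg _).trans (hL x.1 x.2 0)

/-- Every positive power of the 0-1 mask has mean `p`, so `p` enters once. Two factors of `g` use
the second moment; the others are bounded by `L`. -/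
lemma IsDiluteModel.abs_integral_pow_le (h : IsDiluteModel P p ξ X) {g : ℝ → ℝ}
    (hg : Measurable g) {L : ℝ} (hL0 : 0 ≤ L) (hL : ∀ x, |g x| ≤ L) (i : Fin N) (j : Fin n)
    (hg2 : ∫ ω, g (X i j ω) ^ 2 ∂P ≤ 1) {k : ℕ} (hk : 2 ≤ k) :
    |∫ ω, (ξ i j ω * g (X i j ω)) ^ k ∂P| ≤ p * L ^ (k - 2) := by
  rw [h.integral_pow hg, integral_mask_pow (h.law_mask i j) (by omega), abs_mul,
    abs_of_nonneg p.2.1]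
  have hp := p.2.1
  gcongr
  have hmeas : Measurable fun ω => g (X i j ω) := hg.comp (h.measurable_entry i j)
  have hint2 : Integrable (fun ω => g (X i j ω) ^ 2) P :=
    Integrable.of_bound (C := L ^ 2) (hmeas.pow_const 2).aestronglyMeasurable
      (Filter.Eventually.of_forall fun ω => by
        rw [norm_pow]; exact pow_le_pow_left₀ (norm_nonneg _) (hL _) 2)
  have hintk : Integrable (fun ω => g (X i j ω) ^ k) P :=
    Integrable.of_bound (C := L ^ k) (hmeas.pow_const k).aestronglyMeasurable
      (Filter.Eventually.of_forall fun ω => by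
        rw [norm_pow]; exact pow_le_pow_left₀ (norm_nonneg _) (hL _) k)
  calc |∫ ω, g (X i j ω) ^ k ∂P| ≤ ∫ ω, |g (X i j ω) ^ k| ∂P := abs_integral_le_integral_abs
    _ ≤ ∫ ω, L ^ (k - 2) * g (X i j ω) ^ 2 ∂P := by
        refine integral_mono hintk.abs (hint2.const_mul _) fun ω => ?_
        have : |g (X i j ω) ^ k| = |g (X i j ω)| ^ (k - 2) * g (X i j ω) ^ 2 := by
          rw [abs_pow, ← sq_abs (g _), ← pow_add]
          congr 1; omega
        simp only [this]
        gcongr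
        exact hL _
    _ = L ^ (k - 2) * ∫ ω, g (X i j ω) ^ 2 ∂P := integral_const_mul _ _
    _ ≤ L ^ (k - 2) * 1 := by gcongr
    _ = _ := mul_one _

end Model

/-! ### Tail bounds at a given truncation level. -/

section L2Norm

open scoped Matrix.Norms.L2Operator

section Model

variable {Ω : Type*} [MeasurableSpace Ω] {P : Measure Ω} [IsProbabilityMeasure P] {N n : ℕ}
  {p : unitInterval} {ξ X : Fin N → Fin n → Ω → ℝ}

/-- Tail bound for the norm of a masked matrix with bounded centered entries. -/
lemma IsDiluteModel.measureReal_norm_le (h : IsDiluteModel P p ξ X) (hn : 1 ≤ n) (hnN : n < N)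
    (hp : 0 < (p : ℝ)) {k r : ℕ} (hr : 2 * (2 ^ (k + 1) + 1) ^ 2 ≤ r) (hrN : r ≤ N)
    {g : Fin N → Fin n → ℝ → ℝ} (hg : ∀ i j, Measurable (g i j)) {L : ℝ} (hL0 : 0 ≤ L)
    (hL : ∀ i j x, |g i j x| ≤ L) (hLr : L ^ 2 ≤ p * N / r)
    (hg1 : ∀ i j, ∫ ω, g i j (X i j ω) ∂P = 0) (hg2 : ∀ i j, ∫ ω, g i j (X i j ω) ^ 2 ∂P ≤ 1) :
    P.real {ω | 2 * Real.exp 28 * √(N * p) ≤ ‖Matrix.of fun i j => ξ i j ω * g i j (X i j ω)‖} ≤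
      8 * N * Real.exp (-2) ^ 2 ^ (k + 1) := by
  have hN : (0 : ℝ) < N := by
    have : 0 < N := by omega
    exact_mod_cast this
  have hr0 : (0 : ℝ) < r := by
    have : 0 < r := lt_of_lt_of_le (by positivity) hr
    exact_mod_cast this
  -- This `D` satisfies `(r/N) D² = p` and `L ≤ D`, which turns `p L ^ (l - 2)` into `(r/N) D ^ l`.
  set D : ℝ := √(p * N / r) with hDdef
  have hD2 : D ^ 2 = p * N / r := Real.sq_sqrt (by positivity)
  have hD0 : 0 < D := Real.sqrt_pos.2 (by positivity)
  have hLD : L ≤ D := Real.le_sqrt_of_sq_le hLr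
  have hq : (r : ℝ) / N * D ^ 2 = p := by rw [hD2]; field_simp
  have hmom : ∀ i j l, 2 ≤ l → |∫ ω, (ξ i j ω * g i j (X i j ω)) ^ l ∂P| ≤
      (r : ℝ) / Fintype.card (Fin N) * D ^ l := by
    intro i j l hl
    refine (h.abs_integral_pow_le (hg i j) hL0 (hL i j) i j (hg2 i j) hl).trans ?_
    rw [Fintype.card_fin]
    calc (p : ℝ) * L ^ (l - 2) ≤ p * D ^ (l - 2) := by gcongr
      _ = (r : ℝ) / N * (D ^ 2 * D ^ (l - 2)) := by rw [← mul_assoc, hq]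
      _ = _ := by rw [← pow_add, Nat.add_sub_cancel' hl]
  obtain ⟨hint, htr⟩ := integral_trace_le (P := P) (I := Fin N) (J := Fin n) (m := 2 ^ (k + 1))
    (r := r) (by simpa using Nat.lt_of_succ_le hn) (by simpa using hnN.le) (by positivity) hr (by simpa using hrN)
    (fun i j ω => ξ i j ω * g i j (X i j ω)) hD0.le (h.integrable_prod hg hL) (h.integral_prod hg)
    (fun i j => by simp) (fun i j => by
      rw [h.integral_pow (hg i j)]
      simp [hg1]) hmom
  set ε : ℝ := ((2 * Real.exp 28 * √(N * p)) ^ 2) ^ 2 ^ (k + 1) with hε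
  have hε0 : 0 < ε := by positivity
  have hmarkov := mul_meas_ge_le_integral_of_nonneg (Filter.Eventually.of_forall fun ω =>
    le_trans (by positivity) (Matrix.norm_pow_le_trace
      (Matrix.of fun i j => ξ i j ω * g i j (X i j ω)) k)) hint ε
  have hsub : P.real {ω | 2 * Real.exp 28 * √(N * p) ≤
        ‖Matrix.of fun i j => ξ i j ω * g i j (X i j ω)‖} ≤ _ :=
    measureReal_mono fun ω hω => (show ε ≤ _ from le_trans
      (by rw [hε]; gcongr; exact hω) (Matrix.norm_pow_le_trace
      (Matrix.of fun i j => ξ i j ω * g i j (X i j ω)) k))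
  have hfin : ε * P.real {ω | 2 * Real.exp 28 * √(N * p) ≤
        ‖Matrix.of fun i j => ξ i j ω * g i j (X i j ω)‖} ≤
      ε * (8 * N * Real.exp (-2) ^ 2 ^ (k + 1)) := by
    refine (mul_le_mul_of_nonneg_left hsub hε0.le).trans (hmarkov.trans (htr.trans (le_of_eq ?_)))
    -- The squared threshold carries `exp 56` against `exp 54` in the trace bound; the surplus `exp
    -- (-2)` gives the decay.
    have h1 : 4 * Real.exp 54 * r * D ^ 2 = (2 * Real.exp 28 * √(N * p)) ^ 2 * Real.exp (-2) := by
      rw [hD2, mul_pow, mul_pow, Real.sq_sqrt (by positivity),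
        show (54 : ℝ) = 28 + 28 + (-2) by norm_num, Real.exp_add, Real.exp_add]
      field_simp
      ring
    rw [h1, mul_pow, Fintype.card_fin]
    ring
  exact le_of_mul_le_mul_left hfin hε0

/-- Tail bound for the largest singular value in terms of a truncation level `T`. -/
lemma IsDiluteModel.measureReal_largestSingularValue_le (h : IsDiluteModel P p ξ X)
    (hn : 1 ≤ n) (hnN : n < N) (hp : 0 < (p : ℝ)) {k r : ℕ}
    (hr : 2 * (2 ^ (k + 1) + 1) ^ 2 ≤ r) (hrN : r ≤ N) {s M T : ℝ} (hs : 0 ≤ s) (hM : 0 ≤ M)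
    (hT : 0 < T)
    (hX : ∀ j k, Integrable (fun ω => |X j k ω| ^ (1 + s)) P ∧
      ∫ ω, |X j k ω| ^ (1 + s) ∂P ≤ M)
    (hTr : (2 * T) ^ 2 ≤ p * N / r) (hMT : M / T ^ s ≤ T) (hMN : N * (M / T ^ s) ≤ √(N * p)) :
    P.real {ω | (2 * Real.exp 28 + 1) * √(N * p) ≤ largestSingularValue (diluteMatrix ξ X ω)} ≤
      N * N * (M / T ^ (1 + s)) + 8 * N * Real.exp (-2) ^ 2 ^ (k + 1) := by
  set c : Fin N → Fin n → ℝ := fun i j => ∫ ω, truncate T (X i j ω) ∂P with hc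
  set g : Fin N → Fin n → ℝ → ℝ := fun i j x => truncate T x - c i j with hgdef
  have hTs : 0 < T ^ s := Real.rpow_pos_of_pos hT s
  have hXint : ∀ i j, Integrable (X i j) P := fun i j =>
    ((memLp_two_iff_integrable_sq (h.measurable_entry i j).aestronglyMeasurable).2
      (h.integrable_sq i j)).integrable one_le_two
  have hcle : ∀ i j, |c i j| ≤ M / T ^ s := fun i j =>
    abs_integral_truncate_le (h.measurable_entry i j) (hXint i j) hT hs (h.mean_zero i j)
      (hX i j).1 (hX i j).2
  have hgm : ∀ i j, Measurable (g i j) := fun i j => (measurable_truncate T).sub_const _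
  have hgL : ∀ i j x, |g i j x| ≤ 2 * T := fun i j x => by
    calc |truncate T x - c i j| ≤ |truncate T x| + |c i j| := abs_sub _ _
      _ ≤ T + T := add_le_add (abs_truncate_le hT.le x) ((hcle i j).trans hMT)
      _ = 2 * T := by ring
  have hg1 : ∀ i j, ∫ ω, g i j (X i j ω) ∂P = 0 := fun i j => by
    simp only [hgdef]
    rw [integral_sub (integrable_truncate (h.measurable_entry i j) hT.le) (integrable_const _)]
    simp [hc]
  have hg2 : ∀ i j, ∫ ω, g i j (X i j ω) ^ 2 ∂P ≤ 1 := fun i j =>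
    (integral_truncate_sub_sq_le (h.measurable_entry i j) (h.integrable_sq i j) hT.le).trans
      (h.variance_one i j).le
  have hnorm := h.measureReal_norm_le hn hnN hp hr hrN hgm (by positivity) hgL hTr hg1 hg2
  set E₁ : Set Ω := ⋃ x : Fin N × Fin n, {ω | T < |X x.1 x.2 ω|} with hE₁
  set E₂ : Set Ω := {ω | 2 * Real.exp 28 * √(N * p) ≤
    ‖Matrix.of fun i j => ξ i j ω * g i j (X i j ω)‖} with hE₂
  have hE₁le : P.real E₁ ≤ N * N * (M / T ^ (1 + s)) := by
    calc P.real E₁ ≤ ∑ x : Fin N × Fin n, P.real {ω | T < |X x.1 x.2 ω|} :=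
          measureReal_iUnion_fintype_le _
      _ ≤ ∑ _x : Fin N × Fin n, M / T ^ (1 + s) :=
          Finset.sum_le_sum fun x _ => measureReal_lt_abs_le hT (by linarith) (hX _ _).1 (hX _ _).2
      _ = N * n * (M / T ^ (1 + s)) := by simp
      _ ≤ _ := by gcongr
  have hsub : {ω | (2 * Real.exp 28 + 1) * √(N * p) ≤
      largestSingularValue (diluteMatrix ξ X ω)} ≤ᵐ[P] (E₁ ∪ E₂ : Set Ω) := by
    have h1 : ∀ᵐ ω ∂P, ∀ x : Fin N × Fin n, ξ x.1 x.2 ω = 1 ∨ ξ x.1 x.2 ω = 0 :=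
      ae_all_iff.2 fun x => ae_mem_zero_one_of_hasLaw (h.law_mask x.1 x.2)
    filter_upwards [h1] with ω hω
    intro (hle : (2 * Real.exp 28 + 1) * √(N * p) ≤ largestSingularValue (diluteMatrix ξ X ω))
    by_cases hω₁ : ω ∈ E₁
    · exact Or.inl hω₁
    refine Or.inr ?_
    simp only [hE₁, Set.mem_iUnion, not_exists, Set.mem_ofPred_eq, not_lt] at hω₁
    -- Outside `E₁` truncation changes nothing, so only the masked means separate the matrix from
    -- its centred version.
    have hdec : diluteMatrix ξ X ω = (Matrix.of fun i j => ξ i j ω * g i j (X i j ω)) +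
        Matrix.of fun i j => ξ i j ω * c i j := by
      ext i j
      simp only [diluteMatrix, Matrix.of_apply, Matrix.add_apply, hgdef, truncate,
        if_pos (hω₁ (i, j))]
      ring
    have hW : ‖(Matrix.of fun i j => ξ i j ω * c i j : Matrix (Fin N) (Fin n) ℝ)‖ ≤
        √(N * p) := by
      refine le_trans (abs_le_of_sq_le_sq' ?_ (by positivity)).2 hMN
      refine (Matrix.l2_opNorm_sq_le_sum_sq _).trans ?_
      calc _ ≤ ∑ i : Fin N, ∑ j : Fin n, (M / T ^ s) ^ 2 := by
            refine Finset.sum_le_sum fun i _ => Finset.sum_le_sum fun j _ => ?_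
            rw [Matrix.of_apply, ← sq_abs]
            refine pow_le_pow_left₀ (abs_nonneg _) ?_ 2
            rw [abs_mul]
            rcases hω (i, j) with h2 | h2 <;> simp only at h2 <;> rw [h2]
            · rw [abs_one, one_mul]; exact hcle i j
            · rw [abs_zero, zero_mul]; positivity
        _ = N * n * (M / T ^ s) ^ 2 := by simp [mul_assoc]
        _ ≤ N * N * (M / T ^ s) ^ 2 := by gcongr
        _ = _ := by ring
    have h3 := hle.trans (largestSingularValue_le_norm hn _)
    rw [hdec] at h3
    have h4 := h3.trans (norm_add_le _ _)
    show 2 * Real.exp 28 * √(N * p) ≤ _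
    linarith
  calc _ ≤ P.real (E₁ ∪ E₂) := ENNReal.toReal_mono (measure_ne_top _ _) (measure_mono_ae hsub)
    _ ≤ P.real E₁ + P.real E₂ := measureReal_union_le _ _
    _ ≤ _ := add_le_add hE₁le hnorm

end Model

end L2Norm

/-! ### Choice of parameters and conclusion. -/

open Filter in
lemma eventually_log_rpow_le (a : ℝ) {s c : ℝ} (hs : 0 < s) (hc : 0 < c) :
    ∀ᶠ x : ℝ in atTop, Real.log x ^ a ≤ c * x ^ s := by
  filter_upwards [(isLittleO_log_rpow_rpow_atTop a hs).bound hc, eventually_ge_atTop 1]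
    with x hx hx1
  rw [Real.norm_of_nonneg (Real.rpow_nonneg (Real.log_nonneg hx1) _),
    Real.norm_of_nonneg (by positivity)] at hx
  exact hx

/-- The tail bound for all sufficiently large sizes. -/
lemma eventually_measureReal_largestSingularValue_le {δ M B : ℝ} (hδ : 0 < δ) (hM : 0 < M)
    (hB : 0 < B) : ∀ᶠ x : ℝ in Filter.atTop, ∀ (N n : ℕ), (N : ℝ) = x → 1 ≤ n → n < N →
      ∀ (Ω : Type*) [MeasurableSpace Ω] (P : Measure Ω) [IsProbabilityMeasure P]
        (p : unitInterval) (ξ X : Fin N → Fin n → Ω → ℝ),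
        IsDiluteModel P p ξ X →
        (∀ j k, Integrable (fun ω => |X j k ω| ^ (4 + δ)) P ∧
          ∫ ω, |X j k ω| ^ (4 + δ) ∂P ≤ M) →
        B / Real.log N ^ 4 ≤ (p : ℝ) →
        P.real {ω | (2 * Real.exp 28 + 1) * √(N * (p : ℝ)) ≤
          largestSingularValue (diluteMatrix ξ X ω)} ≤ (M + 8) / Real.log N ^ δ := by
  set ϰ := sparsityExponent δ with hϰ
  have hϰ0 : 0 < ϰ := by rw [hϰ, sparsityExponent]; positivity
  have hϰe : (1 - ϰ) / 2 * (4 + δ) = 2 + δ / 4 := by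
    rw [hϰ, sparsityExponent]; field_simp; ring
  filter_upwards [eventually_log_rpow_le (2 : ℕ) one_pos (c := 1 / 18) (by norm_num),
    eventually_log_rpow_le (6 : ℕ) hϰ0 (c := B / 72) (by positivity),
    eventually_log_rpow_le (4 : ℕ) one_pos (c := B / M ^ 2) (by positivity),
    eventually_log_rpow_le δ (s := δ / 4) (by positivity) one_pos,
    eventually_log_rpow_le δ one_pos one_pos, Filter.eventually_ge_atTop M,
    Filter.eventually_ge_atTop (1 : ℝ), Real.tendsto_log_atTop.eventually_ge_atTop 1]
    with x e1 e2 e3 e4 e5 e6 e7 e8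
  rintro N n rfl hn hnN Ω _ P _ p ξ X h hX hpB
  rw [Real.rpow_natCast, Real.rpow_one] at e1 e3
  rw [Real.rpow_natCast] at e2
  rw [Real.rpow_one, one_mul] at e5
  rw [one_mul] at e4
  set l := Real.log N with hl
  have hl0 : 0 < l := by linarith
  have hN0 : (0 : ℝ) < N := by linarith
  have hp : 0 < (p : ℝ) := lt_of_lt_of_le (by positivity) hpB
  have hBp : B ≤ p * l ^ 4 := (div_le_iff₀ (by positivity)).1 hpB
  -- The order `m = 2 ^ (k + 1)` lies between `log N` and `2 log N`: large enough for `exp (-2 m) ≤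
  -- N⁻²`, small enough for `r = O(log² N)`.
  obtain ⟨k, hk1, hk2⟩ := exists_nat_pow_near e8 (one_lt_two)
  set r : ℕ := 2 * (2 ^ (k + 1) + 1) ^ 2 with hr
  have hr18 : (r : ℝ) ≤ 18 * l ^ 2 := by
    have h1 : (2 : ℝ) ^ (k + 1) + 1 ≤ 3 * l := by rw [pow_succ]; linarith
    calc (r : ℝ) = 2 * (2 ^ (k + 1) + 1) ^ 2 := by rw [hr]; push_cast; rfl
      _ ≤ 2 * (3 * l) ^ 2 := by gcongr
      _ = _ := by ring
  have hr0 : (0 : ℝ) < r := by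
    have : 0 < r := by positivity
    exact_mod_cast this
  have hrN : r ≤ N := by
    have : (r : ℝ) ≤ N := by linarith
    exact_mod_cast this
  set T : ℝ := (N : ℝ) ^ ((1 - ϰ) / 2) with hTdef
  have hT0 : 0 < T := Real.rpow_pos_of_pos hN0 _
  have hϰ1 : ϰ < 1 := by
    rw [hϰ, sparsityExponent, div_lt_one (by positivity)]; linarith
  have hT1 : 1 ≤ T := Real.one_le_rpow e7 (by linarith)
  have hT4 : T ^ (4 + δ) = (N : ℝ) ^ 2 * (N : ℝ) ^ (δ / 4) := by
    rw [hTdef, ← Real.rpow_mul hN0.le, hϰe, Real.rpow_add hN0]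
    norm_cast
  have hNδ : 1 ≤ (N : ℝ) ^ (δ / 4) := Real.one_le_rpow e7 (by positivity)
  have hT4' : (N : ℝ) ^ 2 ≤ T ^ (4 + δ) := by
    rw [hT4]; exact le_mul_of_one_le_right (by positivity) hNδ
  have hT2 : T ^ 2 * (N : ℝ) ^ ϰ = N := by
    rw [hTdef, ← Real.rpow_natCast, ← Real.rpow_mul hN0.le, ← Real.rpow_add hN0]
    convert Real.rpow_one _ using 2
    push_cast; ring
  have hs : (1 : ℝ) + (3 + δ) = 4 + δ := by ring
  have hTs : 0 < T ^ (3 + δ) := Real.rpow_pos_of_pos hT0 _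
  have hmain := h.measureReal_largestSingularValue_le hn hnN hp (k := k) (r := r) le_rfl hrN
    (s := 3 + δ) (M := M) (T := T) (by positivity) hM.le hT0 (by rw [hs]; exact hX) ?_ ?_ ?_
  · refine hmain.trans ?_
    rw [hs, add_div]
    have hlδ : 0 < l ^ δ := Real.rpow_pos_of_pos hl0 _
    gcongr ?_ + ?_
    · rw [hT4]
      calc (N : ℝ) * N * (M / (N ^ 2 * (N : ℝ) ^ (δ / 4))) = M / (N : ℝ) ^ (δ / 4) := by
            field_simp
        _ ≤ _ := by gcongr
    · have h1 : Real.exp (-2) ^ 2 ^ (k + 1) ≤ ((N : ℝ) ^ 2)⁻¹ := by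
        rw [← Real.exp_nat_mul, ← Real.exp_log (show 0 < ((N : ℝ) ^ 2)⁻¹ by positivity),
          Real.exp_le_exp, Real.log_inv, Real.log_pow]
        push_cast
        linarith
      calc 8 * (N : ℝ) * Real.exp (-2) ^ 2 ^ (k + 1) ≤ 8 * N * ((N : ℝ) ^ 2)⁻¹ := by gcongr
        _ = 8 / N := by field_simp
        _ ≤ _ := by gcongr
  -- The condition `4 T² r ≤ p N`: `N ^ ϰ`, gained from `T² = N ^ (1 - ϰ)`, beats `log²` from `r`
  -- and `log⁴` from `1/p`.
  · rw [le_div_iff₀ hr0]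
    have hl4 : 0 < l ^ 4 := by positivity
    refine le_of_mul_le_mul_right ?_ hl4
    calc (2 * T) ^ 2 * r * l ^ 4 ≤ (2 * T) ^ 2 * (18 * l ^ 2) * l ^ 4 := by gcongr
      _ = T ^ 2 * (72 * l ^ 6) := by ring
      _ ≤ T ^ 2 * (B * (N : ℝ) ^ ϰ) := mul_le_mul_of_nonneg_left (by linarith) (by positivity)
      _ = B * (T ^ 2 * (N : ℝ) ^ ϰ) := by ring
      _ = B * N := by rw [hT2]
      _ ≤ p * l ^ 4 * N := by gcongr
      _ = _ := by ring
  · rw [div_le_iff₀ hTs, ← Real.rpow_one_add' hT0.le (by positivity), hs]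
    refine le_trans ?_ hT4'
    nlinarith
  -- Since `2 (3 + δ) ≥ 4 + δ`, one has `T ^ (3 + δ) ≥ N`. The masked means thus contribute at most
  -- `M`, and `M² ≤ N p` for large `N`.
  · refine Real.le_sqrt_of_sq_le ?_
    have h1 : (N : ℝ) ^ 2 ≤ (T ^ (3 + δ)) ^ 2 := by
      refine hT4'.trans ?_
      rw [← Real.rpow_natCast, ← Real.rpow_mul hT0.le]
      exact Real.rpow_le_rpow_of_exponent_le hT1 (by push_cast; linarith)
    calc (N * (M / T ^ (3 + δ))) ^ 2 = N ^ 2 / (T ^ (3 + δ)) ^ 2 * M ^ 2 := by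
          field_simp
      _ ≤ 1 * M ^ 2 := by
          gcongr
          exact div_le_one_of_le₀ h1 (by positivity)
      _ ≤ N * p := by
          have hl4 : 0 < l ^ 4 := by positivity
          refine le_of_mul_le_mul_right ?_ hl4
          calc 1 * M ^ 2 * l ^ 4 ≤ 1 * M ^ 2 * (B / M ^ 2 * N) := by gcongr
            _ = B * N := by field_simp
            _ ≤ p * l ^ 4 * N := by gcongr
            _ = _ := by ring

theorem mainTheorem4 (δ M B Q : ℝ) (hδ : 0 < δ) (hM : 0 < M) (hB : 0 < B) (hQ : 1 ≤ Q) :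
    ∃ K C : ℝ, 0 < K ∧ 0 < C ∧
      ∀ (N n : ℕ), 1 ≤ n → n < N →
      ∀ (Ω : Type*) [MeasurableSpace Ω] (P : Measure Ω) [IsProbabilityMeasure P]
        (p : unitInterval) (ξ X : Fin N → Fin n → Ω → ℝ),
        IsDiluteModel P p ξ X →
        (∀ j k, Integrable (fun ω => |X j k ω| ^ (4 + δ)) P ∧
          ∫ ω, |X j k ω| ^ (4 + δ) ∂P ≤ M) →
        B * Real.log N ^ (3 / (2 * sparsityExponent δ)) ≤ N * (p : ℝ) →
        B / Real.log N ^ 4 ≤ (p : ℝ) →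
        P.real {ω | K * √(N * (p : ℝ)) ≤ largestSingularValue (diluteMatrix ξ X ω)} ≤
          C * (N : ℝ) ^ (-Q) + C / Real.log N ^ δ := by
  obtain ⟨x₀, hx₀⟩ :=
    Filter.eventually_atTop.1 (eventually_measureReal_largestSingularValue_le hδ hM hB)
  have hC0 : 0 ≤ Real.log (max x₀ 1) ^ δ :=
    Real.rpow_nonneg (Real.log_nonneg (le_max_right _ _)) _
  -- The logarithmic summand in `C` makes the bound at least `1` when `N ≤ x₀`; `max x₀ 1` keeps
  -- that logarithm nonnegative.
  refine ⟨2 * Real.exp 28 + 1, M + 8 + Real.log (max x₀ 1) ^ δ, by positivity, by positivity, ?_⟩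
  intro N n hn hnN Ω _ P _ p ξ X h hX _ hpB
  have hN : (1 : ℝ) < N := by
    have : 1 < N := by omega
    exact_mod_cast this
  have hl : 0 < Real.log N ^ δ := Real.rpow_pos_of_pos (Real.log_pos hN) _
  -- The logarithmic term alone carries the estimate.
  refine le_trans ?_ (le_add_of_nonneg_left (by positivity))
  rcases le_total x₀ N with hx | hx
  · refine (hx₀ N hx N n rfl hn hnN Ω P p ξ X h hX hpB).trans ?_
    exact div_le_div_of_nonneg_right (by linarith) hl.le
  · refine measureReal_le_one.trans ?_
    rw [le_div_iff₀ hl, one_mul]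
    have : Real.log N ^ δ ≤ Real.log (max x₀ 1) ^ δ := by
      have h0 := Real.log_pos hN
      gcongr
      exact hx.trans (le_max_left _ _)
    linarith
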